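/- Let $R$ be a Noetherian integrally closed domain with field of fractions $K$, let $m\ge 0$, $A=R[x_0^{\pm1},\dots,x_m^{\pm1}]$ and $B=R[y_1^{\pm1},\dots,y_m^{\pm1}]$, with fields of fractions $K(\mathbf x)$ and $K(\mathbf y)$. Let $H$ be an $A$-algebra which is free and finitely generated as an $A$-module, with a symmetrizing form $t:H\to A$ (an $A$-linear form with $t(ab)=t(ba)$ such that $a\mapsto(h\mapsto t(ah))$ is an isomorphism $H\to\mathrm{Hom}_A(H,A)$), and such that $K(\mathbf x)H:=K(\mathbf x)\otimes_A H$ is split semisimple. For $\chi\in\mathrm{Irr}(K(\mathbf x)H)$ let $\chi^\vee\in K(\mathbf x)H$ be the element with $t(\chi^\vee h)=\chi(h)$ for all $h$, and let the Schur element $s_\chi\in K(\mathbf x)$ be the scalar by which the central element $\chi^\vee$ acts on a simple module with character $\chi$. Assume that $H$ is essential, that is, for every $\chi\in\mathrm{Irr}(K(\mathbf x)H)$, $$s_\chi=\xi_\chi N_\chi\prod_{i\in I_\chi}\Psi_{\chi,i}(M_{\chi,i})^{n_{\chi,i}},$$ where $\xi_\chi\in R$, $N_\chi$ is a monomial of degree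 $0$ in $A$, $I_\chi$ is a finite set, each $\Psi_{\chi,i}\in R[x]$ is monic of degree at least $1$, irreducible over $K$, prime to $x$ and to $x-1$ in $K[x]$ and with constant term a unit of $R$, each $M_{\chi,i}$ is a monomial of degree $0$ in $A$ whose exponents have gcd $1$, and the $n_{\chi,i}$ are positive integers. (A monomial is a product $\prod_j x_j^{c_j}$ with $c_j\in\mathbb Z$; its degree is $\sum_j c_j$.) Let $M=\prod_{i=0}^m x_i^{a_i}$ with $a=(a_0,\dots,a_m)\in\mathbb Z^{m+1}$ and $\gcd(a_i)=1$, and let $\varphi_M:A\to B$ be an $R$-algebra morphism associated with $M$, i.e. the morphism induced, on exponents of monomials, by a surjective homomorphism $\mathbb Z^{m+1}\to\mathbb Z^m$ with kernel $\mathbb Za$. Let $H_{\varphi_M}=B\otimes_A H$, with $B$ viewed as an $A$-algebra through $\varphi_M$. Let $\mathfrak p$ be a prime ideal of $R$ and $\mathfrak q_M=\mathfrak pA+(M-1)A$. Then $K(\mathbf y)H_{\varphi_M}$ is split semisimple, the ideals $\mathfrak q_M$ of $A$ and $\mathfrak pB$ of $B$ are prime, and $\varphi_M$ induces a bijection $\mathrm{Irr}(K(\mathbf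 x)H)\to\mathrm{Irr}(K(\mathbf y)H_{\varphi_M})$, $\chi\mapsto\chi_{\varphi_M}$, where $\chi(h)\in A$ and $\chi_{\varphi_M}(1\otimes h)=\varphi_M(\chi(h))$ for all $h\in H$. Under this bijection the blocks of $B_{\mathfrak pB}H_{\varphi_M}$ coincide with the blocks of $A_{\mathfrak q_M}H$: a subset $C$ of $\mathrm{Irr}(K(\mathbf x)H)$ is a block of $A_{\mathfrak q_M}H$ if and only if $\{\chi_{\varphi_M}:\chi\in C\}$ is a block of $B_{\mathfrak pB}H_{\varphi_M}$. Here a block of $A_{\mathfrak q_M}H$ is the set of characters of those simple $K(\mathbf x)H$-modules on which a given primitive idempotent of the centre of $A_{\mathfrak q_M}H$ acts as the identity, and similarly for $B_{\mathfrak pB}H_{\varphi_M}$. -/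

import Mathlib

open scoped TensorProduct

noncomputable section

namespace EssentialBlocks

universe u v w

/-! ### Characters of algebras over a field -/

section Characters

variable (F : Type u) [Field F] (S : Type v) [Ring S] [Algebra F S]

/-- `V` is a simple `S`-module whose character (the trace of the action) is the linear form `χ`. -/
def Affords (V : Type w) [AddCommGroup V] [Module F V] [Module S V] [IsScalarTower F S V]
    (χ : S →ₗ[F] F) : Prop :=
  IsSimpleModule S V ∧
    ∀ a : S, χ a = LinearMap.trace F V (Algebra.lsmul F F V a)

/-- The set `Irr(S)` of irreducible characters of the `F`-algebra `S`. (Every simple `S`-module is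
a quotient of `S`, so that it suffices to consider modules in the universe of `S`.) -/
def Irr : Type (max u v) :=
  {χ : S →ₗ[F] F // ∃ (V : Type v) (_ : AddCommGroup V) (_ : Module F V) (_ : Module S V)
    (_ : IsScalarTower F S V), Affords F S V χ}

/-- `S` is split: `End_S(V) = F` for every simple `S`-module `V`. -/
def IsSplit : Prop :=
  ∀ (V : Type v) [AddCommGroup V] [Module F V] [Module S V] [IsScalarTower F S V],
    IsSimpleModule S V → Function.Bijective (algebraMap F (Module.End S V))

/-- `S` is split semisimple. -/
def IsSplitSemisimple : Prop :=
  IsSemisimpleRing S ∧ IsSplit F S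

variable {F S}

/-- The element `z` of `S` acts as multiplication by the scalar `c` on a simple module with
character `χ`. For central `z` this says `ω_χ(z) = c`, with `ω_χ` the central character. -/
def ActsBy (χ : Irr F S) (z : S) (c : F) : Prop :=
  ∃ (V : Type v) (_ : AddCommGroup V) (_ : Module F V) (_ : Module S V)
    (_ : IsScalarTower F S V), Affords F S V χ.1 ∧ ∀ x : V, z • x = c • x

end Characters

/-! ### Symmetric algebras and Schur elements -/

section Symmetric

variable {O : Type u} [CommRing O] {S : Type v} [Ring S] [Algebra O S]

/-- The linear form `t` is symmetrizing: it is a trace function and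
`a ↦ (x ↦ t (a x))` is a bijection from `S` onto its dual. -/
def IsSymmetrizing (t : S →ₗ[O] O) : Prop :=
  (∀ a b : S, t (a * b) = t (b * a)) ∧
    Function.Bijective (fun a : S => t ∘ₗ LinearMap.mulLeft O a)

variable (F : Type w) [Field F] [Algebra O F]

/-- The extension of a linear form on `S` to `F ⊗ S`. -/
def extendForm (t : S →ₗ[O] O) : F ⊗[O] S →ₗ[F] F :=
  (TensorProduct.AlgebraTensorModule.rid O F F).toLinearMap ∘ₗ t.baseChange F

variable {F}

/-- `s` is the Schur element `ω_χ(χ^∨)` of `χ` with respect to `t`; here `χ^∨` is the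
element `z` of `F ⊗ S` that satisfies `t (z a) = χ a` for all `a`. -/
def IsSchurElement (t : S →ₗ[O] O) (χ : Irr F (F ⊗[O] S)) (s : F) : Prop :=
  ∃ z : F ⊗[O] S, (∀ a, extendForm F t (z * a) = χ.1 a) ∧ ActsBy χ z s

end Symmetric

/-! ### Blocks -/

/-- Block-idempotents: the primitive idempotents of the centre. -/
structure IsBlockIdempotent {S : Type v} [Ring S] (e : S) : Prop where
  idem : IsIdempotentElem e
  central : e ∈ Set.center S
  ne_zero : e ≠ 0
  primitive : ∀ f g : S, f ∈ Set.center S → g ∈ Set.center S → IsIdempotentElem f →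
    IsIdempotentElem g → f * g = 0 → e = f + g → f = 0 ∨ g = 0

section Blocks

variable (O : Type u) [CommRing O] [IsDomain O]

/-- The algebra `F S = F ⊗_O S` over the field of fractions `F` of `O`. -/
abbrev FracAlgebra (S : Type v) [Ring S] [Algebra O S] : Type (max u v) := FractionRing O ⊗[O] S

/-- The inclusion of the localization `O_P` in the field of fractions of `O`. -/
def locToFrac (P : Ideal O) [P.IsPrime] : Localization.AtPrime P →ₐ[O] FractionRing O :=
  IsLocalization.liftAlgHom (M := P.primeCompl) (f := Algebra.ofId O (FractionRing O))
    (fun y => IsLocalization.map_units (FractionRing O)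
      (⟨y.1, Ideal.primeCompl_le_nonZeroDivisors P y.2⟩ : nonZeroDivisors O))

variable (S : Type v) [Ring S] [Algebra O S]

/-- The blocks of `O_P S`, as subsets of `Irr(F S)` where `F` is the field of fractions of `O`:
the subset that belongs to a block-idempotent `e` of `O_P S` consists of the characters of the
simple modules on which `e` acts as the identity. -/
def blocksAt (P : Ideal O) [P.IsPrime] :
    Set (Set (Irr (FractionRing O) (FracAlgebra O S))) :=
  {C | ∃ e : Localization.AtPrime P ⊗[O] S, IsBlockIdempotent e ∧
    C = {χ | ActsBy χ (Algebra.TensorProduct.map (locToFrac O P) (AlgHom.id O S) e) 1}}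

end Blocks

/-! ### Specialization of an algebra along a ring morphism -/

section Specialization

variable {O : Type u} [CommRing O] {O' : Type w} [CommRing O'] (φ : O →+* O')
  (S : Type v) [Ring S] [Algebra O S]

/-- The specialization `S_φ = O' ⊗_O S`, where `O'` is an `O`-algebra through `φ`. -/
def Specialized : Type (max v w) :=
  letI := φ.toAlgebra
  O' ⊗[O] S

instance : Ring (Specialized φ S) :=
  @Algebra.TensorProduct.instRing O O' S _ _ φ.toAlgebra _ _

instance : Algebra O' (Specialized φ S) :=
  letI := φ.toAlgebra
  @Algebra.TensorProduct.leftAlgebra O O' O' S _ _ _ _ _ _ _ _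

variable {S}

/-- The canonical map `S → S_φ`, `h ↦ 1 ⊗ h`. -/
def specialize (h : S) : Specialized φ S :=
  letI := φ.toAlgebra
  (1 : O') ⊗ₜ[O] h

variable (S)

/-- `σ` is the bijection induced by `φ` between the irreducible characters of `S` over the field
of fractions of `O` and those of `S_φ` over the field of fractions of `O'`: each `χ` takes on `S`
values in `O`, and the values of `σ χ` on `S` are their images under `φ`. -/
def IsTitsBijection [IsDomain O] [IsDomain O']
    (σ : Irr (FractionRing O) (FracAlgebra O S) ≃
      Irr (FractionRing O') (FracAlgebra O' (Specialized φ S))) : Prop :=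
  ∀ χ (h : S), ∃ c : O,
    χ.1 (1 ⊗ₜ[O] h) = algebraMap O (FractionRing O) c ∧
    (σ χ).1 (1 ⊗ₜ[O'] specialize φ h) = algebraMap O' (FractionRing O') (φ c)

end Specialization

/-! ### Laurent polynomials, monomials, essential algebras -/

/-- The ring of Laurent polynomials in `n` indeterminates over `R`. -/
abbrev Laurent (R : Type u) [CommRing R] (n : ℕ) : Type u := AddMonoidAlgebra R (Fin n → ℤ)

section Laurent

variable (R : Type u) [CommRing R]

/-- The monomial `∏ i, x_i ^ a_i`. -/
def monomial {n : ℕ} (a : Fin n → ℤ) : Laurent R n := AddMonoidAlgebra.single a 1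

/-- The ideal `𝔭A + (M - 1)A`, where `M` is the monomial with exponents `a`. -/
def idealQ {n : ℕ} (p : Ideal R) (a : Fin n → ℤ) : Ideal (Laurent R n) :=
  p.map (algebraMap R (Laurent R n)) ⊔ Ideal.span {monomial R a - 1}

variable {R}

/-- `φ` is associated with the monomial with exponents `a`: it is induced by a surjective group
morphism `ℤ^(m+1) → ℤ^m` (on exponents) with kernel `ℤ a`. -/
def IsAssociatedWith {m : ℕ} (a : Fin (m + 1) → ℤ) (φ : Laurent R (m + 1) →ₐ[R] Laurent R m) :
    Prop :=
  ∃ f : (Fin (m + 1) → ℤ) →+ (Fin m → ℤ), Function.Surjective f ∧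
    f.ker = AddSubgroup.zmultiples a ∧ ∀ l, φ (monomial R l) = monomial R (f l)

/-- The algebra `H`, with the symmetrizing form `t`, is essential. -/
def IsEssential [IsDomain R] {n : ℕ} {H : Type v} [Ring H] [Algebra (Laurent R n) H]
    (t : H →ₗ[Laurent R n] Laurent R n) : Prop :=
  ∀ χ : Irr (FractionRing (Laurent R n)) (FracAlgebra (Laurent R n) H),
    ∃ (ξ : R) (N : Fin n → ℤ) (k : ℕ) (Ψ : Fin k → Polynomial R) (M : Fin k → Fin n → ℤ)
      (r : Fin k → ℕ),
      ∑ j, N j = 0 ∧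
      (∀ i, (Ψ i).Monic ∧ 1 ≤ (Ψ i).natDegree ∧
        Irreducible ((Ψ i).map (algebraMap R (FractionRing R))) ∧
        IsCoprime ((Ψ i).map (algebraMap R (FractionRing R))) Polynomial.X ∧
        IsCoprime ((Ψ i).map (algebraMap R (FractionRing R))) (Polynomial.X - 1) ∧
        IsUnit ((Ψ i).coeff 0)) ∧
      (∀ i, ∑ j, M i j = 0 ∧ Finset.univ.gcd (M i) = 1) ∧
      (∀ i, 0 < r i) ∧
      IsSchurElement t χ (algebraMap (Laurent R n) (FractionRing (Laurent R n))
        (algebraMap R (Laurent R n) ξ * monomial R N *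
          ∏ i, (Polynomial.aeval (monomial R (M i)) (Ψ i)) ^ r i))

end Laurent

end EssentialBlocks

end

open EssentialBlocks

open EssentialBlocks
open scoped TensorProduct Matrix

noncomputable section

namespace EssentialBlocks

universe u v w

/-! ### Products of matrix algebras over a field -/

section PiMatrix

variable {F : Type u} [Field F] {S : Type v} [Ring S] [Algebra F S]
  {ι : Type*} {n : ι → ℕ}
  (Φ : S ≃ₐ[F] Π i, Matrix (Fin (n i)) (Fin (n i)) F)

/-! Write `F` and `L` for the fraction fields of `A` and `B`, and let `O` be the localization of `A`
at `ker φ = (M - 1)`. It is a Noetherian local domain with principal maximal ideal, hence a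
principal ideal domain, and it maps to `L`. Over a principal ideal domain the irreducible
representations of `F H` have invariant lattices, so they can be written with entries in `O`
(`exists_integral_model`) and reduced to `L`.

Essentiality keeps `φ` from killing a Schur element: a factor `Ψ(M')` goes either to `Ψ` of a
nontrivial monomial or to `Ψ(1) ≠ 0`. The Schur elements are therefore units of `O`, and by duality
for `t` the image of `H` spans the full product of matrix algebras over `O`
(`exists_eq_single_smul`). Reduction and a dimension count identify `L H_φ` with a product of matrix
algebras of the same sizes (`exists_algEquiv_specialized`). This gives splitness and the bijection
of characters.

Blocks are the minimal nonempty index sets `C` whose indicator has a multiple by some `d` outside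
the prime that comes from the algebra itself (`image_mem_blocksAt_iff`, `isIdempotentSet_iff`). As
`Q = φ⁻¹(P)`, such multiples pass from `A` to `B`. Conversely, a lift `h` of a multiple over `B` has
the right shape only after reduction. Since `A` is integrally closed, characteristic polynomials of
`h` have coefficients in `A`, and Cayley-Hamilton yields a polynomial in `h` with exactly the right
shape, whose scalar is sent by `φ` to a power of `φ d` up to sign
(`exists_eq_scalar_of_map_eq_scalar`). No completion is needed. -/

/-- The irreducible character `a ↦ tr (Φ a i)`. -/
def traceForm (i : ι) : S →ₗ[F] F :=
  Matrix.traceLinearMap (Fin (n i)) F F ∘ₗ LinearMap.proj i ∘ₗ Φ.toLinearEquiv.toLinearMap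

@[simp]
lemma traceForm_apply (i : ι) (a : S) : traceForm Φ i a = (Φ a i).trace := rfl

lemma trace_lsmul {V : Type w} [AddCommGroup V] [Module F V] [Module S V] [IsScalarTower F S V]
    {i : ι} (e : V ≃ₗ[F] (Fin (n i) → F)) (he : ∀ (a : S) (x : V), e (a • x) = Φ a i *ᵥ e x)
    (a : S) : LinearMap.trace F V (Algebra.lsmul F F V a) = (Φ a i).trace := by
  rw [← Matrix.trace_toLin'_eq, ← LinearMap.trace_conj' _ e]
  congr 1
  refine LinearMap.ext fun y => ?_
  simp [LinearEquiv.conj_apply, he]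

variable [DecidableEq ι]

/-- The element of `S` that corresponds to the matrix `E` in the component `i`. -/
def piMatrixSingle (i : ι) (E : Matrix (Fin (n i)) (Fin (n i)) F) : S := Φ.symm (Pi.single i E)

@[simp]
lemma apply_piMatrixSingle (i : ι) (E : Matrix (Fin (n i)) (Fin (n i)) F) :
    Φ (piMatrixSingle Φ i E) = Pi.single i E := by
  simp [piMatrixSingle]

lemma mul_piMatrixSingle (a : S) (i : ι) (E : Matrix (Fin (n i)) (Fin (n i)) F) :
    a * piMatrixSingle Φ i E = piMatrixSingle Φ i (Φ a i * E) := by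
  apply Φ.injective
  ext1 j
  rcases eq_or_ne j i with rfl | h
  · simp
  · simp [h]

/-- Some diagonal matrix unit does not kill a chosen nonzero vector `x`. The corresponding column of
matrices, applied to `x`, is an equivariant copy of the standard module, and simplicity makes it all
of `V`. -/
lemma exists_linearEquiv_of_isSimpleModule [Fintype ι] (V : Type w) [AddCommGroup V]
    [Module F V] [Module S V] [IsScalarTower F S V] [IsSimpleModule S V] :
    ∃ (i : ι) (e : V ≃ₗ[F] (Fin (n i) → F)), ∀ (a : S) (x : V), e (a • x) = Φ a i *ᵥ e x := by
  have := IsSimpleModule.nontrivial S V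
  obtain ⟨x, hx⟩ := exists_ne (0 : V)
  have hsum : (1 : S) = ∑ i, ∑ j, piMatrixSingle Φ i (Matrix.single j j 1) := by
    apply Φ.injective
    ext1 k
    simp only [map_one, map_sum, apply_piMatrixSingle, Finset.sum_apply]
    rw [Finset.sum_eq_single k (fun i _ hi => by simp [Pi.single_eq_of_ne hi.symm]) (by simp)]
    simp only [Pi.single_eq_same, Pi.one_apply]
    exact Matrix.sum_single_one.symm
  obtain ⟨i, j, hij⟩ : ∃ i j, piMatrixSingle Φ i (Matrix.single j j 1) • x ≠ 0 := by
    by_contra! h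
    apply hx
    rw [← one_smul S x, hsum, Finset.sum_smul]
    exact Finset.sum_eq_zero fun i _ => by
      rw [Finset.sum_smul]; exact Finset.sum_eq_zero fun j _ => h i j
  let g : (Fin (n i) → F) →ₗ[F] V :=
    { toFun := fun y => piMatrixSingle Φ i (Matrix.vecMulVec y (Pi.single j 1)) • x
      map_add' := fun y z => by
        simp [piMatrixSingle, Matrix.add_vecMulVec, Pi.single_add, add_smul]
      map_smul' := fun c y => by
        simp [piMatrixSingle, Matrix.smul_vecMulVec, Pi.single_smul] }
  have hg (a : S) (y : Fin (n i) → F) : g (Φ a i *ᵥ y) = a • g y := by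
    change piMatrixSingle Φ i _ • x = a • piMatrixSingle Φ i _ • x
    rw [← mul_smul, mul_piMatrixSingle, Matrix.mul_vecMulVec]
  have hgj : g (Pi.single j 1) ≠ 0 := by
    change piMatrixSingle Φ i _ • x ≠ 0
    rwa [← Matrix.single_eq_single_vecMulVec_single]
  have hsurj : Function.Surjective g := by
    let N : Submodule S V :=
      { carrier := Set.range g
        add_mem' := by rintro _ _ ⟨y, rfl⟩ ⟨z, rfl⟩; exact ⟨y + z, map_add _ _ _⟩
        zero_mem' := ⟨0, map_zero _⟩
        smul_mem' := by rintro a _ ⟨y, rfl⟩; exact ⟨_, hg a y⟩ }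
    have hN : N = ⊤ := (eq_bot_or_eq_top N).resolve_left fun h =>
      hgj ((Submodule.mem_bot S).1 (h ▸ (⟨_, rfl⟩ : g (Pi.single j 1) ∈ N)))
    intro y
    exact (hN ▸ Submodule.mem_top : y ∈ N)
  have hinj : Function.Injective g := by
    rw [injective_iff_map_eq_zero]
    intro y hy
    by_contra hne
    obtain ⟨k, hk⟩ := Function.ne_iff.1 hne
    apply hgj
    have : Pi.single j 1 = Φ (piMatrixSingle Φ i (Matrix.vecMulVec (Pi.single j 1)
        (Pi.single k (y k)⁻¹))) i *ᵥ y := by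
      simp [Matrix.vecMulVec_mulVec, inv_mul_cancel₀ hk]
    rw [this, hg, hy, smul_zero]
  have hbij : Function.Bijective g := ⟨hinj, hsurj⟩
  refine ⟨i, (LinearEquiv.ofBijective g hbij).symm, fun a y => ?_⟩
  obtain ⟨z, rfl⟩ := (LinearEquiv.ofBijective g hbij).surjective y
  rw [LinearEquiv.symm_apply_apply, LinearEquiv.symm_apply_eq]
  exact (hg a z).symm

lemma exists_eq_apply (i : ι) (E : Matrix (Fin (n i)) (Fin (n i)) F) : ∃ a : S, Φ a i = E :=
  ⟨piMatrixSingle Φ i E, by simp⟩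

lemma isSplitSemisimple_of_algEquiv {F : Type u} [Field F] {S : Type v} [Ring S] [Algebra F S]
    {ι : Type*} [Fintype ι] [DecidableEq ι] {n : ι → ℕ}
    (Φ : S ≃ₐ[F] Π i, Matrix (Fin (n i)) (Fin (n i)) F) : IsSplitSemisimple F S := by
  refine ⟨Φ.symm.toRingEquiv.isSemisimpleRing, ?_⟩
  intro V _ _ _ _ hV
  obtain ⟨i, e, he⟩ := exists_linearEquiv_of_isSimpleModule Φ V
  have := IsSimpleModule.nontrivial S V
  refine ⟨?_, fun g => ?_⟩
  · exact FaithfulSMul.algebraMap_injective F (Module.End S V)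
  · let T := LinearMap.toMatrix' (e.toLinearMap ∘ₗ (g.restrictScalars F) ∘ₗ e.symm.toLinearMap)
    have hT (y : Fin (n i) → F) : T *ᵥ y = e (g (e.symm y)) := by
      rw [← Matrix.toLin'_apply, Matrix.toLin'_toMatrix']; rfl
    -- An endomorphism commutes with every matrix, since `Φ` is onto component `i`; central matrices
    -- are scalar.
    have hc : T ∈ Set.center (Matrix (Fin (n i)) (Fin (n i)) F) := by
      rw [Semigroup.mem_center_iff]
      intro E
      obtain ⟨a, rfl⟩ := exists_eq_apply Φ i E
      refine Matrix.mulVec_injective (funext fun y => ?_)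
      simp only [← Matrix.mulVec_mulVec, hT]
      rw [← he, ← map_smul]
      congr 2
      rw [LinearEquiv.eq_symm_apply, he, e.apply_symm_apply]
    rw [Matrix.center_eq_scalar_image] at hc
    obtain ⟨c, -, hc⟩ := hc
    refine ⟨c, LinearMap.ext fun x => e.injective ?_⟩
    have := hT (e x)
    rw [e.symm_apply_apply, ← hc] at this
    rw [← this]
    simp [Module.algebraMap_end_apply, Matrix.scalar_apply]

variable [∀ i, NeZero (n i)]

lemma traceForm_injective : Function.Injective (traceForm Φ) := by
  intro i j hij
  by_contra hne
  -- A matrix unit is tested rather than the identity of the component, whose trace `n i` may vanish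
  -- in `F`.
  have h := congrArg (fun f => f (piMatrixSingle Φ i (Matrix.single 0 0 1))) hij
  simp [Pi.single_eq_of_ne (Ne.symm hne)] at h

lemma exists_simple_module (i : ι) :
    ∃ (V : Type v) (_ : AddCommGroup V) (_ : Module F V) (_ : Module S V)
      (_ : IsScalarTower F S V) (e : V ≃ₗ[F] (Fin (n i) → F)),
      IsSimpleModule S V ∧ ∀ (a : S) (x : V), e (a • x) = Φ a i *ᵥ e x := by
  let f : S →+* Module.End F (Fin (n i) → F) :=
    (Matrix.toLinAlgEquiv' : Matrix (Fin (n i)) (Fin (n i)) F ≃ₐ[F] _).toRingEquiv.toRingHom.comp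
      ((Pi.evalRingHom _ i).comp Φ.toRingEquiv.toRingHom)
  let _ : Module S (Fin (n i) → F) := Module.compHom _ f
  have hsmul (a : S) (y : Fin (n i) → F) : a • y = Φ a i *ᵥ y := rfl
  have : IsScalarTower F S (Fin (n i) → F) := ⟨fun c a y => by
    rw [hsmul, hsmul, map_smul, Pi.smul_apply, Matrix.smul_mulVec]⟩
  have hsimple : IsSimpleModule S (Fin (n i) → F) := by
    rw [isSimpleModule_iff_toSpanSingleton_surjective]
    refine ⟨inferInstance, fun y hy z => ?_⟩
    obtain ⟨k, hk⟩ := Function.ne_iff.1 hy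
    refine ⟨piMatrixSingle Φ i (Matrix.vecMulVec z (Pi.single k (y k)⁻¹)), ?_⟩
    simp [hsmul, Matrix.vecMulVec_mulVec, inv_mul_cancel₀ hk]
  -- The column space lives in the universe of `F`; an isomorphic quotient of `S` lives in that of
  -- `S`, as `Irr` requires.
  obtain ⟨I, hI, ⟨e⟩⟩ := isSimpleModule_iff_quot_maximal.1 hsimple
  refine ⟨S ⧸ I, inferInstance, inferInstance, inferInstance, inferInstance,
    (e.restrictScalars F).symm, ?_, fun a x => ?_⟩
  · exact IsSimpleModule.congr e.symm
  · rw [← hsmul]; exact e.symm.map_smul a x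

/-- The irreducible characters of a product of matrix algebras. -/
def irrEquiv [Fintype ι] : ι ≃ Irr F S :=
  Equiv.ofBijective
    (fun i => ⟨traceForm Φ i, by
      obtain ⟨V, h1, h2, h3, h4, e, hV, he⟩ := exists_simple_module Φ i
      exact ⟨V, h1, h2, h3, h4, hV, fun a => (trace_lsmul Φ e he a).symm⟩⟩)
    ⟨fun i j h => traceForm_injective Φ (congrArg Subtype.val h), by
      rintro ⟨χ, V, h1, h2, h3, h4, hV, hχ⟩
      obtain ⟨i, e, he⟩ := exists_linearEquiv_of_isSimpleModule Φ V
      exact ⟨i, Subtype.ext (LinearMap.ext fun a => by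
        rw [hχ, trace_lsmul Φ e he, traceForm_apply])⟩⟩

lemma irrEquiv_apply [Fintype ι] (i : ι) (a : S) : (irrEquiv Φ i).1 a = (Φ a i).trace := rfl

lemma actsBy_irrEquiv_iff [Fintype ι] (i : ι) (z : S) (c : F) :
    ActsBy (irrEquiv Φ i) z c ↔ Φ z i = Matrix.scalar (Fin (n i)) c := by
  have key {V : Type v} [AddCommGroup V] [Module F V] [Module S V] [IsScalarTower F S V]
      (e : V ≃ₗ[F] (Fin (n i) → F)) (he : ∀ (a : S) (x : V), e (a • x) = Φ a i *ᵥ e x) :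
      (∀ x : V, z • x = c • x) ↔ Φ z i = Matrix.scalar (Fin (n i)) c := by
    refine ⟨fun h => Matrix.mulVec_injective (funext fun y => ?_), fun h x => e.injective ?_⟩
    · have := congrArg e (h (e.symm y))
      rw [he, map_smul, e.apply_symm_apply] at this
      simpa [Matrix.scalar_apply] using this
    · rw [he, h, map_smul]
      simp [Matrix.scalar_apply]
  constructor
  · rintro ⟨V, h1, h2, h3, h4, ⟨hV, hχ⟩, hz⟩
    obtain ⟨j, e, he⟩ := exists_linearEquiv_of_isSimpleModule Φ V
    have : i = j := traceForm_injective Φ (LinearMap.ext fun a => by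
      have := hχ a
      rwa [trace_lsmul Φ e he] at this)
    subst this
    exact (key e he).1 hz
  · intro h
    obtain ⟨V, h1, h2, h3, h4, e, hV, he⟩ := exists_simple_module Φ i
    exact ⟨V, h1, h2, h3, h4, ⟨hV, fun a => (trace_lsmul Φ e he a).symm⟩, (key e he).2 h⟩

lemma eq_zero_or_one_of_isIdempotentElem {e : S} (he : IsIdempotentElem e)
    (hc : e ∈ Set.center S) (i : ι) : Φ e i = 0 ∨ Φ e i = 1 := by
  have hc' : Φ e i ∈ Set.center (Matrix (Fin (n i)) (Fin (n i)) F) := by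
    rw [Semigroup.mem_center_iff] at hc ⊢
    intro E
    obtain ⟨a, rfl⟩ := exists_eq_apply Φ i E
    rw [← Pi.mul_apply, ← Pi.mul_apply, ← map_mul, ← map_mul, hc]
  rw [Matrix.center_eq_scalar_image] at hc'
  obtain ⟨c, -, hc'⟩ := hc'
  have hid : IsIdempotentElem c := by
    have h2 : Φ e i * Φ e i = Φ e i := by rw [← Pi.mul_apply, ← map_mul, he.eq]
    rw [← hc', ← map_mul] at h2
    exact (Matrix.scalar_inj).1 h2
  rcases IsIdempotentElem.iff_eq_zero_or_one.1 hid with rfl | rfl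
  · left; rw [← hc', map_zero]
  · right; rw [← hc', map_one]

end PiMatrix

/-- A split semisimple algebra is a product of matrix algebras. -/
lemma exists_algEquiv_of_isSplitSemisimple {F : Type u} [Field F] {S : Type v} [Ring S]
    [Algebra F S] (h : IsSplitSemisimple F S) :
    ∃ (k : ℕ) (n : Fin k → ℕ), (∀ i, NeZero (n i)) ∧
      Nonempty (S ≃ₐ[F] Π i, Matrix (Fin (n i)) (Fin (n i)) F) := by
  obtain ⟨hss, hsplit⟩ := h
  obtain ⟨k, I, n, hI, hn, ⟨e⟩⟩ :=
    IsSemisimpleRing.exists_algEquiv_pi_matrix_end_mulOpposite F S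
  refine ⟨k, n, hn, ⟨e.trans (AlgEquiv.piCongrRight fun i => AlgEquiv.mapMatrix ?_)⟩⟩
  refine (AlgEquiv.ofBijective (Algebra.ofId F _) ?_).symm
  have := hsplit (I i) (hI i)
  have h2 : ⇑(Algebra.ofId F (Module.End S (I i))ᵐᵒᵖ) =
    MulOpposite.op ∘ algebraMap F (Module.End S (I i)) := rfl
  rw [h2]
  exact MulOpposite.opEquiv.bijective.comp this

/-! ### Integral models of a split semisimple algebra -/

lemma exists_smul_eq_one_tmul {A : Type*} [CommRing A] (W : Submonoid A) (A' : Type*) [CommRing A']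
    [Algebra A A'] [IsLocalization W A'] {H : Type*} [AddCommGroup H] [Module A H]
    (z : A' ⊗[A] H) : ∃ d ∈ W, ∃ h : H, algebraMap A A' d • z = 1 ⊗ₜ[A] h := by
  obtain ⟨⟨h, d⟩, hd⟩ := IsLocalizedModule.surj W (TensorProduct.mk A A' H 1) z
  exact ⟨d, d.2, h, by rw [algebraMap_smul]; exact hd⟩

/-! ### Nondegeneracy of the symmetrizing form over the fraction field. -/

section Form

variable {A : Type*} [CommRing A] {F : Type*} [Field F] [Algebra A F]
  {H : Type*} [Ring H] [Algebra A H] {t : H →ₗ[A] A}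

@[simp]
lemma extendForm_one_tmul (h : H) : extendForm F t (1 ⊗ₜ[A] h) = algebraMap A F (t h) := by
  simp [extendForm, Algebra.algebraMap_eq_smul_one]

lemma eq_zero_of_extendForm_mul_eq_zero [IsFractionRing A F] (ht : IsSymmetrizing t)
    {z : F ⊗[A] H} (hz : ∀ h : H, extendForm F t (z * 1 ⊗ₜ[A] h) = 0) : z = 0 := by
  obtain ⟨d, hd, h, hdh⟩ := exists_smul_eq_one_tmul (nonZeroDivisors A) F z
  have hd0 : algebraMap A F d ≠ 0 :=
    (IsLocalization.map_units F (⟨d, hd⟩ : nonZeroDivisors A)).ne_zero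
  have hh : h = 0 := by
    apply ht.2.1
    ext x
    apply IsFractionRing.injective A F
    have := congrArg (algebraMap A F d • ·) (hz x)
    simp only [← map_smul, ← smul_mul_assoc, hdh, Algebra.TensorProduct.tmul_mul_tmul, one_mul,
      extendForm_one_tmul, smul_zero] at this
    simpa using this
  rw [hh, TensorProduct.tmul_zero] at hdh
  exact (smul_eq_zero.1 hdh).resolve_left hd0

end Form

/-- An algebra morphism to a matrix algebra whose values have entries in `O` factors
through the matrices over `O`. -/
lemma exists_algHom_matrix_of_entries {A O F : Type*} [CommRing A] [CommRing O] [CommRing F]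
    [Algebra A O] [Algebra O F] [Algebra A F] [IsScalarTower A O F]
    (hinj : Function.Injective (algebraMap O F))
    {H : Type*} [Ring H] [Algebra A H] {k : ℕ} (f : H →ₐ[A] Matrix (Fin k) (Fin k) F)
    (hf : ∀ h i j, f h i j ∈ Set.range (algebraMap O F)) :
    ∃ ρ : H →ₐ[A] Matrix (Fin k) (Fin k) O, ∀ h, f h = (ρ h).map (algebraMap O F) := by
  let g : Matrix (Fin k) (Fin k) O →ₐ[A] Matrix (Fin k) (Fin k) F :=
    (IsScalarTower.toAlgHom A O F).mapMatrix
  have hg : Function.Injective g := Matrix.map_injective hinj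
  have hr (h : H) : f h ∈ g.range := by
    choose c hc using hf h
    exact ⟨Matrix.of c, by ext i j; exact hc i j⟩
  refine ⟨(AlgEquiv.ofInjective g hg).symm.toAlgHom.comp (f.codRestrict g.range hr), fun h => ?_⟩
  exact (congrArg Subtype.val
    ((AlgEquiv.ofInjective g hg).apply_symm_apply (f.codRestrict g.range hr h))).symm

/-! ### Invariant lattices over a principal ideal domain. -/

section Model

variable {A O F : Type*} [CommRing A] [CommRing O] [IsDomain O] [IsPrincipalIdealRing O] [Field F]
  [Algebra A O] [Algebra O F] [Algebra A F] [IsScalarTower A O F] [IsFractionRing O F]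
  {H : Type*} [Ring H] [Algebra A H] [Module.Finite A H]

/-- A matrix representation over `F` of `H` that is irreducible over `F` is equivalent to one over
the principal ideal domain `O`. -/
lemma exists_basis_integral {k : ℕ} [NeZero k] (f : F ⊗[A] H →ₐ[F] Matrix (Fin k) (Fin k) F)
    (hf : Function.Surjective f) :
    ∃ b : Module.Basis (Fin k) F (Fin k → F), ∀ (h : H) i j,
      LinearMap.toMatrixAlgEquiv b (Matrix.toLinAlgEquiv' (f (1 ⊗ₜ[A] h))) i j ∈
        Set.range (algebraMap O F) := by
  let y : Fin k → F := Pi.single 0 1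
  let g : H →ₗ[A] (Fin k → F) :=
    { toFun := fun h => f (1 ⊗ₜ[A] h) *ᵥ y
      map_add' := fun h h' => by rw [TensorProduct.tmul_add, map_add, Matrix.add_mulVec]
      map_smul' := fun c h => by
        rw [← TensorProduct.smul_tmul, ← algebraMap_smul F c (1 : F), ← TensorProduct.smul_tmul',
          map_smul, Matrix.smul_mulVec, algebraMap_smul, RingHom.id_apply] }
  -- The lattice generated by the orbit of `y` is finitely generated because `H` is, and spans
  -- because surjectivity of `f` lets `y` be moved to any vector. It is free because `O` is a
  -- principal ideal domain.
  let Λ : Submodule O (Fin k → F) := Submodule.span O (Set.range g)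
  have hmem (h : H) : g h ∈ Λ := Submodule.subset_span ⟨h, rfl⟩
  have hstable (h : H) (x : Fin k → F) (hx : x ∈ Λ) : f (1 ⊗ₜ[A] h) *ᵥ x ∈ Λ := by
    induction hx using Submodule.span_induction with
    | mem x hx =>
      obtain ⟨h', rfl⟩ := hx
      have : f (1 ⊗ₜ[A] h) *ᵥ g h' = g (h * h') := by
        change _ *ᵥ (_ *ᵥ y) = _ *ᵥ y
        rw [Matrix.mulVec_mulVec, ← map_mul, Algebra.TensorProduct.tmul_mul_tmul, one_mul]
      rw [this]
      exact hmem _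
    | zero => rw [Matrix.mulVec_zero]; exact Λ.zero_mem
    | add x x' _ _ hx hx' => rw [Matrix.mulVec_add]; exact Λ.add_mem hx hx'
    | smul c x _ hx => rw [Matrix.mulVec_smul]; exact Λ.smul_mem c hx
  have hlat : Submodule.IsLattice F Λ := by
    constructor
    · obtain ⟨s, hs⟩ := Module.Finite.fg_top (R := A) (M := H)
      have : Λ = Submodule.span O (g '' s) := by
        rw [← Submodule.span_span_of_tower A O (g '' s), ← Submodule.map_span, hs]
        rw [Submodule.map_top, LinearMap.coe_range]
      rw [this]
      exact Submodule.fg_span (s.finite_toSet.image g)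
    · rw [Submodule.span_span_of_tower, eq_top_iff]
      intro x _
      obtain ⟨z, hz⟩ := hf (Matrix.vecMulVec x y)
      have hx : x = f z *ᵥ y := by
        rw [hz, Matrix.vecMulVec_mulVec]; simp [y]
      rw [hx]
      clear hz hx
      induction z using TensorProduct.induction_on with
      | zero => simp
      | add z z' hz hz' => rw [map_add, Matrix.add_mulVec]; exact Submodule.add_mem _ hz hz'
      | tmul c h =>
        have : c ⊗ₜ[A] h = c • ((1 : F) ⊗ₜ[A] h) := by
          rw [TensorProduct.smul_tmul', smul_eq_mul, mul_one]
        rw [this, map_smul, Matrix.smul_mulVec]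
        exact Submodule.smul_mem _ _ (Submodule.subset_span ⟨h, rfl⟩)
  let b₀ : Module.Basis (Fin k) O Λ := Module.finBasisOfFinrankEq O Λ (by
    rw [Submodule.IsLattice.finrank_of_pi F Λ, Fintype.card_fin])
  refine ⟨b₀.extendOfIsLattice F, fun h i j => ?_⟩
  rw [LinearMap.toMatrixAlgEquiv_apply, Matrix.toLinAlgEquiv'_apply,
    Module.Basis.extendOfIsLattice_apply]
  set x : Λ := ⟨_, hstable h _ (b₀ j).2⟩ with hx
  refine ⟨b₀.repr x i, ?_⟩
  have h1 : (x : Fin k → F) =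
      ∑ i, algebraMap O F (b₀.repr x i) • b₀.extendOfIsLattice F i := by
    have := congrArg Subtype.val (b₀.sum_repr x)
    rw [Submodule.coe_sum] at this
    simp only [Module.Basis.extendOfIsLattice_apply, algebraMap_smul]
    exact this.symm
  have h2 := congrArg (fun w => (b₀.extendOfIsLattice F).repr w i) h1
  rw [Module.Basis.repr_sum_self] at h2
  exact h2.symm

lemma exists_integral_model {ι : Type*} [Fintype ι] [DecidableEq ι] {n : ι → ℕ}
    [∀ i, NeZero (n i)] (Φ₀ : F ⊗[A] H ≃ₐ[F] Π i, Matrix (Fin (n i)) (Fin (n i)) F) :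
    ∃ (Φ : F ⊗[A] H ≃ₐ[F] Π i, Matrix (Fin (n i)) (Fin (n i)) F)
      (ρ : Π i, H →ₐ[A] Matrix (Fin (n i)) (Fin (n i)) O),
      ∀ h i, Φ (1 ⊗ₜ[A] h) i = (ρ i h).map (algebraMap O F) := by
  have hb (i : ι) := exists_basis_integral (O := O) (A := A)
    ((Pi.evalAlgHom F _ i).comp Φ₀.toAlgHom) (fun E => exists_eq_apply Φ₀ i E)
  choose b hb using hb
  let Φ : F ⊗[A] H ≃ₐ[F] Π i, Matrix (Fin (n i)) (Fin (n i)) F :=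
    Φ₀.trans (AlgEquiv.piCongrRight fun i =>
      Matrix.toLinAlgEquiv'.trans (LinearMap.toMatrixAlgEquiv (b i)))
  have hρ (i : ι) := exists_algHom_matrix_of_entries (A := A) (IsFractionRing.injective O F)
    ((((Pi.evalAlgHom F _ i).comp Φ.toAlgHom).restrictScalars A).comp
      (Algebra.TensorProduct.includeRight : H →ₐ[A] F ⊗[A] H)) (hb i)
  choose ρ hρ using hρ
  exact ⟨Φ, ρ, fun h i => hρ i h⟩

end Model

/-- A linear form with values in a localization of `A` has a common denominator. -/
lemma exists_linearMap_of_localization {A O : Type*} [CommRing A] [CommRing O] [Algebra A O]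
    (W : Submonoid A) [IsLocalization W O]
    {H : Type*} [AddCommGroup H] [Module A H] [Module.Free A H] [Module.Finite A H]
    (g : H →ₗ[A] O) :
    ∃ d ∈ W, ∃ l : H →ₗ[A] A, ∀ h, algebraMap A O (l h) = algebraMap A O d * g h := by
  let b := Module.Free.chooseBasis A H
  obtain ⟨d, hd⟩ := IsLocalization.exist_integer_multiples_of_finite W (fun i => g (b i))
  choose c hc using hd
  refine ⟨d, d.2, b.constr ℕ c, fun h => ?_⟩
  have : Algebra.linearMap A O ∘ₗ b.constr ℕ c = LinearMap.mulLeft A (algebraMap A O d) ∘ₗ g :=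
    b.ext fun i => by simp [hc, Algebra.smul_def]
  exact LinearMap.congr_fun this h

/-! ### Schur elements as denominators. -/

section Schur

variable {A O F : Type*} [CommRing A] [CommRing O] [Field F]
  [Algebra A O] [Algebra O F] [Algebra A F] [IsScalarTower A O F] [IsFractionRing O F]
  {H : Type*} [Ring H] [Algebra A H] {t : H →ₗ[A] A}
  {ι : Type*} [Fintype ι] [DecidableEq ι] {n : ι → ℕ} [∀ i, NeZero (n i)]
  (Φ : F ⊗[A] H ≃ₐ[F] Π i, Matrix (Fin (n i)) (Fin (n i)) F)

lemma schurElement_mul_piMatrixSingle {i : ι} {s : F} {z : F ⊗[A] H}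
    (hz : ActsBy (irrEquiv Φ i) z s) (E : Matrix (Fin (n i)) (Fin (n i)) F) :
    z * piMatrixSingle Φ i E = piMatrixSingle Φ i (s • E) := by
  rw [mul_piMatrixSingle, (actsBy_irrEquiv_iff Φ i z s).1 hz, Matrix.scalar_apply,
    ← Matrix.smul_eq_diagonal_mul]

lemma schurElement_ne_zero {i : ι} {s : F} (hs : IsSchurElement t (irrEquiv Φ i) s) : s ≠ 0 := by
  rintro rfl
  obtain ⟨z, hz, hact⟩ := hs
  have h := hz (piMatrixSingle Φ i (Matrix.single 0 0 1))
  rw [schurElement_mul_piMatrixSingle Φ hact, zero_smul, irrEquiv_apply] at h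
  simp [piMatrixSingle] at h

/-- Where the Schur elements are invertible, the representations of `H` over `O` are jointly
surjective after localization. -/
lemma exists_eq_single_smul [IsFractionRing A F] [Module.Free A H] [Module.Finite A H]
    (P : Ideal A) [P.IsPrime] [IsLocalization.AtPrime O P]
    (ht : IsSymmetrizing t) (ρ : Π i, H →ₐ[A] Matrix (Fin (n i)) (Fin (n i)) O)
    (hρ : ∀ h i, Φ (1 ⊗ₜ[A] h) i = (ρ i h).map (algebraMap O F)) (i : ι) {s : A} (hsP : s ∉ P)
    (hs : IsSchurElement t (irrEquiv Φ i) (algebraMap A F s))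
    (E : Matrix (Fin (n i)) (Fin (n i)) O) :
    ∃ d ∉ P, ∃ h : H, ρ i h = algebraMap A O d • E ∧ ∀ j ≠ i, ρ j h = 0 := by
  have hOF := IsFractionRing.injective O F
  let g : H →ₗ[A] O := Matrix.traceLinearMap (Fin (n i)) A O ∘ₗ
    LinearMap.mulLeft A E ∘ₗ (ρ i).toLinearMap
  have hg (h : H) : g h = (E * ρ i h).trace := rfl
  obtain ⟨d, hd, l, hl⟩ := exists_linearMap_of_localization P.primeCompl g
  -- Here `h` is dual to `x ↦ d * tr(E ρ_i(x))`. Over `F` the same form is represented by `d • (z *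
  -- E')`, with `z = χ^∨` acting on component `i` as `s`; hence the denominator `d * s`.
  obtain ⟨h, hh⟩ := ht.2.2 l
  obtain ⟨z, hz, hact⟩ := hs
  let E' : Matrix (Fin (n i)) (Fin (n i)) F := E.map (algebraMap O F)
  have hkey : (1 : F) ⊗ₜ[A] h = algebraMap A F d • (z * piMatrixSingle Φ i E') := by
    rw [← sub_eq_zero]
    apply eq_zero_of_extendForm_mul_eq_zero ht
    intro x
    have h1 : extendForm F t ((1 : F) ⊗ₜ[A] h * 1 ⊗ₜ[A] x) = algebraMap A F (l x) := by
      rw [Algebra.TensorProduct.tmul_mul_tmul, one_mul, extendForm_one_tmul, ← hh]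
      rfl
    have h2 : extendForm F t (z * piMatrixSingle Φ i E' * 1 ⊗ₜ[A] x) =
        algebraMap O F (g x) := by
      rw [mul_assoc, hz, irrEquiv_apply, map_mul, apply_piMatrixSingle, Pi.mul_apply,
        Pi.single_eq_same, hρ, hg, ← Matrix.map_mul]
      exact (AddMonoidHom.map_trace (algebraMap O F).toAddMonoidHom _).symm
    rw [sub_mul, map_sub, h1, smul_mul_assoc, map_smul, h2,
      IsScalarTower.algebraMap_apply A O F, hl, map_mul, ← IsScalarTower.algebraMap_apply A O F,
      smul_eq_mul, sub_self]
  have hΦ : Φ (1 ⊗ₜ[A] h) = Pi.single i (algebraMap A F (d * s) • E') := by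
    rw [hkey, map_smul, schurElement_mul_piMatrixSingle Φ hact, apply_piMatrixSingle,
      ← Pi.single_smul, smul_smul, map_mul]
  refine ⟨d * s, fun hds => ((‹P.IsPrime›.mem_or_mem hds).elim hd hsP), h, ?_, fun j hj => ?_⟩
  · apply Matrix.map_injective hOF
    dsimp only
    rw [← hρ, hΦ, Pi.single_eq_same]
    ext j k
    simp [E', IsScalarTower.algebraMap_apply A O F]
  · apply Matrix.map_injective hOF
    dsimp only
    rw [← hρ, hΦ, Pi.single_eq_of_ne hj]
    ext
    simp

end Schur

/-! ### Characteristic polynomials -/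

-- Over an algebraic closure, every eigenvalue is a root of any monic polynomial over `A` that kills
-- `T`. The coefficients are polynomial expressions in the eigenvalues.
open Polynomial in
lemma isIntegral_coeff_charpoly {A F : Type*} [CommRing A] [Field F] [Algebra A F] {k : ℕ}
    {T : Matrix (Fin k) (Fin k) F} (hT : IsIntegral A T) (i : ℕ) :
    IsIntegral A (T.charpoly.coeff i) := by
  obtain ⟨g, hg, hgT⟩ := hT
  let K := AlgebraicClosure F
  let f : Matrix (Fin k) (Fin k) F →ₐ[A] Matrix (Fin k) (Fin k) K :=
    (IsScalarTower.toAlgHom A F K).mapMatrix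
  refine (isIntegral_algHom_iff (IsScalarTower.toAlgHom A F K)
    (FaithfulSMul.algebraMap_injective F K)).1 ?_
  have hc : T.charpoly.map (algebraMap F K) = (f T).charpoly :=
    (Matrix.charpoly_map T (algebraMap F K)).symm
  rw [IsScalarTower.coe_toAlgHom', ← coeff_map, hc]
  refine isIntegral_coeff_of_factors _ ?_ (IsAlgClosed.splits _) (fun x hx => ?_) i
  · rw [(Matrix.charpoly_monic _).leadingCoeff]; exact isIntegral_one
  · rcases Nat.eq_zero_or_pos k with rfl | hk
    · simp at hx
    have : Nonempty (Fin k) := ⟨⟨0, hk⟩⟩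
    have hx' := Matrix.mem_spectrum_iff_isRoot_charpoly.2 hx
    have h0 : aeval (f T) (g.map (algebraMap A K)) = 0 := by
      rw [aeval_map_algebraMap, aeval_algHom_apply]
      have : aeval T g = 0 := hgT
      rw [this, map_zero]
    have := spectrum.subset_polynomial_aeval (f T) (g.map (algebraMap A K)) ⟨x, hx', rfl⟩
    rw [h0, spectrum.zero_eq] at this
    exact ⟨g, hg, by simpa [eval_map] using this⟩

open Polynomial in
/-- Over an integrally closed ring, the characteristic polynomial of an integral element in a
representation has coefficients in that ring. -/
lemma exists_map_eq_charpoly {A O F : Type*} [CommRing A] [IsDomain A] [IsIntegrallyClosed A]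
    [CommRing O] [Field F] [Algebra A O] [Algebra O F] [Algebra A F] [IsScalarTower A O F]
    [IsFractionRing A F] (hinj : Function.Injective (algebraMap O F))
    {H : Type*} [Ring H] [Algebra A H] [Module.Finite A H] {k : ℕ}
    (ρ : H →ₐ[A] Matrix (Fin k) (Fin k) O) (h : H) :
    ∃ f : A[X], f.map (algebraMap A O) = (ρ h).charpoly := by
  have hint : IsIntegral A ((ρ h).map (algebraMap O F)) :=
    (Algebra.IsIntegral.isIntegral h).map
      ((IsScalarTower.toAlgHom A O F).mapMatrix.comp ρ)
  have hl : ((ρ h).map (algebraMap O F)).charpoly ∈ lifts (algebraMap A F) := by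
    rw [lifts_iff_coeff_lifts]
    intro i
    exact IsIntegrallyClosed.isIntegral_iff.1 (isIntegral_coeff_charpoly hint i)
  obtain ⟨f, hf⟩ := hl
  refine ⟨f, map_injective _ hinj ?_⟩
  rw [map_map, ← IsScalarTower.algebraMap_eq, ← Matrix.charpoly_map]
  exact hf

/-! ### The specialized algebra -/

section Specialized

variable {A : Type u} [CommRing A] {B : Type w} [CommRing B] (φ : A →+* B)
  (H : Type v) [Ring H] [Algebra A H]

variable {H}

lemma specialize_surjective (hφ : Function.Surjective φ) :
    Function.Surjective (specialize φ : H → Specialized φ H) := by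
  let _ := φ.toAlgebra
  exact Algebra.TensorProduct.includeRight_surjective H hφ

instance [Module.Free A H] : Module.Free B (Specialized φ H) :=
  let _ := φ.toAlgebra
  inferInstanceAs (Module.Free B (B ⊗[A] H))

instance [Module.Finite A H] : Module.Finite B (Specialized φ H) :=
  let _ := φ.toAlgebra
  inferInstanceAs (Module.Finite B (B ⊗[A] H))

lemma finrank_specialized [Module.Free A H] [StrongRankCondition A] [StrongRankCondition B] :
    Module.finrank B (Specialized φ H) = Module.finrank A H :=
  let _ := φ.toAlgebra
  Module.finrank_baseChange (R := B) (S := A) (M' := H)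

/-- A morphism from `H` that is semilinear along `φ` factors through `H_φ`. -/
lemma exists_algHom_specialized {T : Type*} [Ring T] [Algebra B T] (f : H →+* T)
    (hf : ∀ a, f (algebraMap A H a) = algebraMap B T (φ a)) :
    ∃ g : Specialized φ H →ₐ[B] T, ∀ h, g (specialize φ h) = f h := by
  let _ := φ.toAlgebra
  let _ : Algebra A T := Algebra.compHom T φ
  have : IsScalarTower A B T := IsScalarTower.of_algebraMap_eq fun _ => rfl
  let f' : H →ₐ[A] T := { f with commutes' := hf }
  let g : B ⊗[A] H →ₐ[B] T :=
    Algebra.TensorProduct.lift (Algebra.ofId B T) f' fun b h => Algebra.commutes b (f' h)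
  refine ⟨g, fun h => ?_⟩
  have : g (1 ⊗ₜ h) = Algebra.ofId B T 1 * f' h := Algebra.TensorProduct.lift_tmul _ _ _ _ _
  rw [map_one, one_mul] at this
  exact this

end Specialized

/-! ### The specialized algebra as a product of matrix algebras. -/

section Reduction

variable {A : Type u} [CommRing A] [IsDomain A] {B : Type w} [CommRing B] [IsDomain B]
  {φ : A →+* B} {H : Type v} [Ring H] [Algebra A H] [Module.Free A H] [Module.Finite A H]
  {O F L : Type*} [CommRing O] [Algebra A O] [Field F] [Algebra A F] [Field L] [Algebra B L]
  [IsFractionRing B L] {ι : Type*} [Fintype ι] [DecidableEq ι] {n : ι → ℕ}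

/-- Representations over `O` that are jointly surjective up to denominators outside `ker φ`
identify the specialized algebra with a product of matrix algebras. -/
lemma exists_algEquiv_specialized (Φ : F ⊗[A] H ≃ₐ[F] Π i, Matrix (Fin (n i)) (Fin (n i)) F)
    (ρ : Π i, H →ₐ[A] Matrix (Fin (n i)) (Fin (n i)) O)
    (hsurj : ∀ (i : ι) (E : Matrix (Fin (n i)) (Fin (n i)) O), ∃ d, φ d ≠ 0 ∧ ∃ h : H,
      ρ i h = algebraMap A O d • E ∧ ∀ j ≠ i, ρ j h = 0)
    (ψ : O →+* L) (hψ : ∀ a, ψ (algebraMap A O a) = algebraMap B L (φ a)) :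
    ∃ Φ' : L ⊗[B] Specialized φ H ≃ₐ[L] Π i, Matrix (Fin (n i)) (Fin (n i)) L,
      ∀ h i, Φ' (1 ⊗ₜ[B] specialize φ h) i = (ρ i h).map ψ := by
  let f : H →+* Π i, Matrix (Fin (n i)) (Fin (n i)) L :=
    RingHom.pi fun i => ψ.mapMatrix.comp (ρ i).toRingHom
  have hf (h : H) (i : ι) : f h i = (ρ i h).map ψ := rfl
  obtain ⟨g, hg⟩ := exists_algHom_specialized φ f (fun a => by
    funext i
    rw [hf, AlgHom.commutes, Matrix.algebraMap_eq_diagonal]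
    ext j k
    simp [Matrix.diagonal_apply, Matrix.algebraMap_matrix_apply, apply_ite ψ, hψ])
  let Φ' : L ⊗[B] Specialized φ H →ₐ[L] Π i, Matrix (Fin (n i)) (Fin (n i)) L :=
    Algebra.TensorProduct.lift (Algebra.ofId L _) g fun c x => Algebra.commutes c (g x)
  have hΦ' (h : H) (i : ι) : Φ' (1 ⊗ₜ[B] specialize φ h) i = (ρ i h).map ψ := by
    have h1 : Φ' (1 ⊗ₜ[B] specialize φ h) = Algebra.ofId L _ 1 * g (specialize φ h) :=
      Algebra.TensorProduct.lift_tmul _ _ _ _ _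
    rw [h1, map_one, one_mul, hg, hf]
  have hsur : Function.Surjective Φ' := by
    rw [← AlgHom.coe_toLinearMap, ← LinearMap.range_eq_top, eq_top_iff]
    intro T _
    have hT : T = ∑ i, ∑ j, ∑ k, T i j k • Pi.single i (Matrix.single j k 1) := by
      conv_lhs => rw [← Finset.univ_sum_single T]
      refine Finset.sum_congr rfl fun i _ => ?_
      conv_lhs => rw [Matrix.matrix_eq_sum_single (T i)]
      ext i' j' k'
      rcases eq_or_ne i' i with rfl | hi
      · simp [Matrix.sum_apply]
      · simp [hi, Matrix.sum_apply]
    rw [hT]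
    refine Submodule.sum_mem _ fun i _ => Submodule.sum_mem _ fun j _ =>
      Submodule.sum_mem _ fun k _ => Submodule.smul_mem _ _ ?_
    obtain ⟨d, hd, h, hh, hh'⟩ := hsurj i (Matrix.single j k 1)
    have hd' : algebraMap B L (φ d) ≠ 0 := fun h0 =>
      hd (IsFractionRing.injective B L (h0.trans (map_zero _).symm))
    refine ⟨(algebraMap B L (φ d))⁻¹ • (1 ⊗ₜ[B] specialize φ h), ?_⟩
    rw [AlgHom.coe_toLinearMap, map_smul]
    funext i'
    rw [Pi.smul_apply, hΦ']
    rcases eq_or_ne i' i with rfl | hi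
    · rw [hh, Pi.single_eq_same]
      ext j' k'
      rw [Matrix.smul_apply, Matrix.map_apply, Matrix.smul_apply, Matrix.single_apply,
        Matrix.single_apply, smul_eq_mul, smul_eq_mul, map_mul, hψ, apply_ite ψ, map_one, map_zero]
      split_ifs <;> simp [hd']
    · rw [hh' i' hi, Pi.single_eq_of_ne hi]
      ext
      simp
  -- Both dimensions equal the rank of `H` over `A`, which `Φ` computes as `∑ i, n i ^ 2`;
  -- surjectivity then suffices.
  have hrank : Module.finrank L (L ⊗[B] Specialized φ H) =
      Module.finrank L (Π i, Matrix (Fin (n i)) (Fin (n i)) L) := by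
    have h1 := Φ.toLinearEquiv.finrank_eq
    rw [Module.finrank_baseChange] at h1
    rw [Module.finrank_baseChange, finrank_specialized, h1]
    simp [Module.finrank_pi_fintype, Module.finrank_matrix]
  have hinj : Function.Injective Φ' :=
    (LinearMap.injective_iff_surjective_of_finrank_eq_finrank (f := Φ'.toLinearMap) hrank).2 hsur
  exact ⟨AlgEquiv.ofBijective Φ' ⟨hinj, hsur⟩, hΦ'⟩

end Reduction

/-! ### Blocks of a product of matrix algebras -/

section Blocks

variable {O : Type u} [CommRing O] [IsDomain O] {S : Type v} [Ring S] [Algebra O S]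
  {ι : Type*} {n : ι → ℕ}

/-- The idempotent of the product of matrix algebras that is the identity in the components of `C`
and zero elsewhere. -/
def piIndicator (F : Type*) [Field F] (n : ι → ℕ) (C : Set ι) :
    Π i, Matrix (Fin (n i)) (Fin (n i)) F :=
  open scoped Classical in fun i => if i ∈ C then 1 else 0

lemma smul_piIndicator_of_mem {F : Type*} [Field F] (c : F) {C : Set ι} {i : ι} (hi : i ∈ C) :
    (c • piIndicator F n C) i = Matrix.scalar (Fin (n i)) c := by
  rw [Pi.smul_apply, piIndicator, if_pos hi, Matrix.scalar_apply, Matrix.smul_one_eq_diagonal]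

lemma smul_piIndicator_of_notMem {F : Type*} [Field F] (c : F) {C : Set ι} {i : ι} (hi : i ∉ C) :
    (c • piIndicator F n C) i = 0 := by
  rw [Pi.smul_apply, piIndicator, if_neg hi, smul_zero]

lemma piIndicator_injective (F : Type*) [Field F] [∀ i, NeZero (n i)] :
    Function.Injective (piIndicator F n) := by
  intro C D h
  ext i
  have := congrFun h i
  by_cases hC : i ∈ C <;> by_cases hD : i ∈ D <;> simp_all [piIndicator]

variable (P : Ideal O) [P.IsPrime]

/-- The map `O_P ⊗ S → F ⊗ S`. -/
abbrev locMap (S : Type v) [Ring S] [Algebra O S] :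
    Localization.AtPrime P ⊗[O] S →ₐ[O] FracAlgebra O S :=
  Algebra.TensorProduct.map (locToFrac O P) (AlgHom.id O S)

lemma locToFrac_injective : Function.Injective (locToFrac O P) := by
  have h : (locToFrac O P : Localization.AtPrime P → FractionRing O) =
    IsLocalization.lift (M := P.primeCompl) (g := algebraMap O (FractionRing O)) _ := rfl
  rw [h, IsLocalization.lift_injective_iff]
  intro x y
  rw [(IsLocalization.injective (Localization.AtPrime P)
    P.primeCompl_le_nonZeroDivisors).eq_iff, (IsFractionRing.injective O (FractionRing O)).eq_iff]

lemma locMap_injective [Module.Flat O S] : Function.Injective (locMap P S) :=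
  Module.Flat.rTensor_preserves_injective_linearMap (M := S) (locToFrac O P).toLinearMap
    (locToFrac_injective P)

variable
  (Φ : FracAlgebra O S ≃ₐ[FractionRing O] Π i, Matrix (Fin (n i)) (Fin (n i)) (FractionRing O))

/-- The set `C` belongs to a central idempotent of `O_P S`. -/
def IsIdempotentSet (C : Set ι) : Prop :=
  ∃ e : Localization.AtPrime P ⊗[O] S, Φ (locMap P S e) = piIndicator _ n C

/-- Clearing denominators removes the localization, leaving a condition on elements of `S` and `O`
that can be carried along a ring morphism. -/
lemma isIdempotentSet_iff (C : Set ι) :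
    IsIdempotentSet P Φ C ↔ ∃ d ∉ P, ∃ h : S,
      Φ (1 ⊗ₜ[O] h) = algebraMap O (FractionRing O) d • piIndicator _ n C := by
  constructor
  · rintro ⟨e, he⟩
    obtain ⟨d, hd, h, hh⟩ := exists_smul_eq_one_tmul P.primeCompl (Localization.AtPrime P) e
    refine ⟨d, hd, h, ?_⟩
    have : (1 : FractionRing O) ⊗ₜ[O] h = locMap P S (1 ⊗ₜ[O] h) := by
      simp [locMap]
    rw [this, ← hh, algebraMap_smul, map_smul, ← algebraMap_smul (FractionRing O) d, map_smul, he]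
  · rintro ⟨d, hd, h, hh⟩
    have hd' : algebraMap O (FractionRing O) d ≠ 0 := fun h0 =>
      hd (by rw [IsFractionRing.injective O (FractionRing O) (h0.trans (map_zero _).symm)]
             exact P.zero_mem)
    refine ⟨IsLocalization.mk' (M := P.primeCompl) _ 1 ⟨d, hd⟩ ⊗ₜ[O] h, ?_⟩
    have h1 : locToFrac O P (IsLocalization.mk' (M := P.primeCompl) _ 1 ⟨d, hd⟩) =
        (algebraMap O (FractionRing O) d)⁻¹ := by
      apply eq_inv_of_mul_eq_one_left
      rw [← AlgHom.commutes (locToFrac O P) d, ← map_mul]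
      have := IsLocalization.mk'_spec (M := P.primeCompl) (Localization.AtPrime P) (1 : O) ⟨d, hd⟩
      rw [this, map_one, map_one]
    have h2 : locMap P S (IsLocalization.mk' (M := P.primeCompl) _ 1 ⟨d, hd⟩ ⊗ₜ[O] h) =
        (algebraMap O (FractionRing O) d)⁻¹ • ((1 : FractionRing O) ⊗ₜ[O] h) := by
      rw [TensorProduct.smul_tmul', smul_eq_mul, mul_one, ← h1]
      rfl
    rw [h2, map_smul, hh, smul_smul, inv_mul_cancel₀ hd', one_smul]

/-- The image of `O_P S` spans `F S` over `F`, so commuting with that image is enough. -/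
lemma locMap_mem_center {e : Localization.AtPrime P ⊗[O] S}
    (he : e ∈ Set.center (Localization.AtPrime P ⊗[O] S)) :
    locMap P S e ∈ Set.center (FracAlgebra O S) := by
  rw [Semigroup.mem_center_iff] at he ⊢
  intro z
  induction z using TensorProduct.induction_on with
  | zero => rw [zero_mul, mul_zero]
  | add x y hx hy => rw [add_mul, mul_add, hx, hy]
  | tmul c h =>
    have h1 : c ⊗ₜ[O] h = c • locMap P S (1 ⊗ₜ[O] h) := by
      rw [Algebra.TensorProduct.map_tmul, map_one, TensorProduct.smul_tmul', smul_eq_mul, mul_one]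
      rfl
    rw [h1, smul_mul_assoc, mul_smul_comm, ← map_mul, ← map_mul, he]

lemma isIdempotent_and_central_of_eq_piIndicator [Module.Flat O S]
    {e : Localization.AtPrime P ⊗[O] S} {C : Set ι}
    (he : Φ (locMap P S e) = piIndicator _ n C) :
    IsIdempotentElem e ∧ e ∈ Set.center (Localization.AtPrime P ⊗[O] S) := by
  have hinj : Function.Injective fun x => Φ (locMap P S x) :=
    Φ.injective.comp (locMap_injective P)
  constructor
  · apply hinj
    simp only [map_mul, he]
    funext i
    by_cases hi : i ∈ C <;> simp [piIndicator, hi]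
  · rw [Semigroup.mem_center_iff]
    intro x
    apply hinj
    simp only [map_mul, he]
    funext i
    by_cases hi : i ∈ C <;> simp [piIndicator, hi]

variable [DecidableEq ι] [∀ i, NeZero (n i)]

lemma exists_eq_piIndicator {e : Localization.AtPrime P ⊗[O] S} (hid : IsIdempotentElem e)
    (hc : e ∈ Set.center (Localization.AtPrime P ⊗[O] S)) :
    ∃ C : Set ι, Φ (locMap P S e) = piIndicator _ n C := by
  refine ⟨{i | Φ (locMap P S e) i = 1}, funext fun i => ?_⟩
  by_cases h : Φ (locMap P S e) i = 1
  · simp [piIndicator, h]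
  · have h0 := (eq_zero_or_one_of_isIdempotentElem Φ (hid.map (locMap P S))
      (locMap_mem_center P hc) i).resolve_right h
    simp [piIndicator, h0]

variable [Fintype ι]

lemma setOf_actsBy_eq {e : Localization.AtPrime P ⊗[O] S} {C : Set ι}
    (he : Φ (locMap P S e) = piIndicator _ n C) :
    {χ | ActsBy χ (locMap P S e) 1} = irrEquiv Φ '' C := by
  ext χ
  obtain ⟨i, rfl⟩ := (irrEquiv Φ).surjective χ
  rw [Set.mem_ofPred_eq, actsBy_irrEquiv_iff, he, map_one, (irrEquiv Φ).injective.mem_set_image]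
  by_cases hi : i ∈ C <;> simp [piIndicator, hi]

/-- The blocks are the minimal nonempty sets that belong to central idempotents. -/
lemma image_mem_blocksAt_iff [Module.Flat O S] (C : Set ι) :
    irrEquiv Φ '' C ∈ blocksAt O S P ↔ IsIdempotentSet P Φ C ∧ C.Nonempty ∧
      ∀ D ⊆ C, IsIdempotentSet P Φ D → D = ∅ ∨ D = C := by
  have hinj : Function.Injective fun x => Φ (locMap P S x) :=
    Φ.injective.comp (locMap_injective P)
  have h0 : piIndicator (FractionRing O) n ∅ = 0 := by
    funext i; simp [piIndicator]
  constructor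
  · rintro ⟨e, he, hC⟩
    obtain ⟨C', hC'⟩ := exists_eq_piIndicator P Φ he.idem he.central
    have : C = C' := (irrEquiv Φ).injective.image_injective (hC.trans (setOf_actsBy_eq P Φ hC'))
    subst this
    refine ⟨⟨e, hC'⟩, ?_, ?_⟩
    · rw [Set.nonempty_iff_ne_empty]
      rintro rfl
      exact he.ne_zero (hinj (by simp only [hC', h0, map_zero]))
    · rintro D hD ⟨f, hf⟩
      -- The complement also belongs to an idempotent, so `e = f + (e - f)` is an orthogonal
      -- decomposition and primitivity applies.
      have hg : Φ (locMap P S (e - f)) = piIndicator _ n (C \ D) := by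
        rw [map_sub, map_sub, hf, hC']
        funext i
        by_cases hi : i ∈ D
        · simp [piIndicator, hi, hD hi]
        · by_cases hi' : i ∈ C <;> simp [piIndicator, hi, hi']
      obtain ⟨hf1, hf2⟩ := isIdempotent_and_central_of_eq_piIndicator P Φ hf
      obtain ⟨hg1, hg2⟩ := isIdempotent_and_central_of_eq_piIndicator P Φ hg
      have hfg : f * (e - f) = 0 := by
        apply hinj
        simp only [map_mul, hf, hg, map_zero]
        funext i
        by_cases hi : i ∈ D <;> simp [piIndicator, hi]
      rcases he.primitive f (e - f) hf2 hg2 hf1 hg1 hfg (by abel) with h | h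
      · left
        apply piIndicator_injective (n := n) (FractionRing O)
        rw [← hf, h, map_zero, map_zero, h0]
      · right
        apply piIndicator_injective (n := n) (FractionRing O)
        rw [← hf, ← hC', sub_eq_zero.1 h]
  · rintro ⟨⟨e, he⟩, hne, hmin⟩
    obtain ⟨he1, he2⟩ := isIdempotent_and_central_of_eq_piIndicator P Φ he
    refine ⟨e, ⟨he1, he2, ?_, ?_⟩, (setOf_actsBy_eq P Φ he).symm⟩
    · rintro rfl
      rw [map_zero, map_zero, ← h0] at he
      exact hne.ne_empty (piIndicator_injective _ he).symm
    · intro f g hf hg hfi hgi hfg hefg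
      obtain ⟨D, hD⟩ := exists_eq_piIndicator P Φ hfi hf
      have hDC : D ⊆ C := by
        intro i hi
        by_contra hiC
        have hef : e * f = f := by
          have : g * f = 0 := by rw [← (Semigroup.mem_center_iff.1 hg f), hfg]
          rw [hefg, add_mul, hfi.eq, this, add_zero]
        have := congrFun (congrArg (fun x => Φ (locMap P S x)) hef) i
        simp only [map_mul, hD, he, Pi.mul_apply] at this
        simp [piIndicator, hi, hiC] at this
      rcases hmin D hDC ⟨f, hD⟩ with rfl | rfl
      · left
        apply hinj
        simp only [hD, h0, map_zero]
      · right
        have : e = f := hinj (by simp only [hD, he])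
        rw [← this] at hefg
        exact left_eq_add.1 hefg

end Blocks

/-! ### Blocks under specialization -/

section Lifting

open Polynomial

variable {A : Type*} [CommRing A] {O : Type*} [CommRing O] [Algebra A O]
  {L : Type*} [Field L] [Algebra A L] (ψ : O →ₐ[A] L)
  {H : Type*} [Ring H] [Algebra A H] {ι : Type*} [Fintype ι] {n : ι → ℕ}

/-- If the image of `h` under `ψ` is a scalar in some components and zero in the others, then a
polynomial in `h` has this property before applying `ψ`. -/
lemma exists_eq_scalar_of_map_eq_scalar (ρ : Π i, H →ₐ[A] Matrix (Fin (n i)) (Fin (n i)) O)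
    (hρ : ∀ i h, ∃ f : A[X], f.map (algebraMap A O) = (ρ i h).charpoly) (C : Set ι) {h : H} {d : A}
    (hC : ∀ i ∈ C, (ρ i h).map ψ = Matrix.scalar _ (algebraMap A L d))
    (hC' : ∀ i ∉ C, (ρ i h).map ψ = 0) :
    ∃ (g : H) (c : A) (k : ℕ), (algebraMap A L c = algebraMap A L d ^ k ∨
        algebraMap A L c = -algebraMap A L d ^ k) ∧
      (∀ i ∈ C, ρ i g = Matrix.scalar _ (algebraMap A O c)) ∧ ∀ i ∉ C, ρ i g = 0 := by
  classical
  let ρ' (i : ι) : H →ₐ[A] Matrix (Fin (n i)) (Fin (n i)) L := ψ.mapMatrix.comp (ρ i)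
  have hρ' (i : ι) (x : H) : ρ' i x = (ρ i x).map ψ := rfl
  choose f hf using hρ
  have hf' (i : ι) (x : H) : (f i x).map (algebraMap A L) = (ρ' i x).charpoly := by
    have h1 : algebraMap A L = (ψ : O →+* L).comp (algebraMap A O) := ψ.comp_algebraMap.symm
    rw [h1, ← Polynomial.map_map, hf, ← Matrix.charpoly_map]
    rfl
  have haev (i : ι) (x : H) {p : A[X]} (hp : f i x ∣ p) : aeval (ρ i x) p = 0 := by
    obtain ⟨q, rfl⟩ := hp
    rw [map_mul, ← aeval_map_algebraMap O, hf, Matrix.aeval_self_charpoly, zero_mul]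
  -- By Cayley-Hamilton `p₀(h)` vanishes exactly off `C`. After `ψ` all factors are powers of `X`,
  -- so on `C` it still reduces to a scalar, a power of `d`.
  let p₀ : A[X] := ∏ i with i ∉ C, f i h
  let k₀ : ℕ := ∑ i with i ∉ C, n i
  have hp₀ : p₀.map (algebraMap A L) = X ^ k₀ := by
    rw [Polynomial.map_prod, ← Finset.prod_pow_eq_pow_sum]
    refine Finset.prod_congr rfl fun i hi => ?_
    rw [hf', hρ', hC' i (Finset.mem_filter.1 hi).2, Matrix.charpoly_zero, Fintype.card_fin]
  let y : H := aeval h p₀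
  have hy (i : ι) (hi : i ∈ C) : ρ' i y = Matrix.scalar _ (algebraMap A L d ^ k₀) := by
    rw [← aeval_algHom_apply, ← aeval_map_algebraMap L, hp₀, aeval_X_pow, hρ', hC i hi, map_pow]
  have hy' (i : ι) (hi : i ∉ C) : ρ i y = 0 := by
    rw [← aeval_algHom_apply]
    exact haev i h (Finset.dvd_prod_of_mem (fun i => f i h) (by simpa using hi))
  -- Now `p₁(y)` vanishes on `C`, while off `C`, where `y` is zero, it equals `p₁(0)`. Thus `p₁(0) -
  -- p₁(y)` is exactly scalar on `C` and zero elsewhere; the sign below is `(-1) ^ k₁`.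
  let p₁ : A[X] := ∏ i with i ∈ C, f i y
  let k₁ : ℕ := ∑ i with i ∈ C, n i
  have hp₁ : p₁.map (algebraMap A L) = (X - Polynomial.C (algebraMap A L d ^ k₀)) ^ k₁ := by
    rw [Polynomial.map_prod, ← Finset.prod_pow_eq_pow_sum]
    refine Finset.prod_congr rfl fun i hi => ?_
    rw [hf', hy i (Finset.mem_filter.1 hi).2, Matrix.scalar_apply, Matrix.charpoly_diagonal]
    simp
  refine ⟨algebraMap A H (p₁.coeff 0) - aeval y p₁, p₁.coeff 0, k₀ * k₁, ?_, fun i hi => ?_,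
    fun i hi => ?_⟩
  · rw [← coeff_map, hp₁, coeff_zero_eq_eval_zero, eval_pow, eval_sub, eval_X, eval_C, zero_sub,
      pow_mul, neg_pow (algebraMap A L d ^ k₀)]
    rcases neg_one_pow_eq_or L k₁ with h | h <;> rw [h] <;> simp
  · have h1 : aeval (ρ i y) p₁ = 0 :=
      haev i y (Finset.dvd_prod_of_mem (fun i => f i y) (by simpa using hi))
    rw [map_sub, ← aeval_algHom_apply, h1, sub_zero, AlgHom.commutes]
    rfl
  · rw [map_sub, ← aeval_algHom_apply, hy' i hi, AlgHom.commutes, aeval_def, eval₂_at_zero,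
      sub_self]

end Lifting

/-! ### Characters and blocks under specialization with principal kernel. -/

section Main

variable {A : Type u} [CommRing A] [IsDomain A] [IsNoetherianRing A] [IsIntegrallyClosed A]
  {B : Type w} [CommRing B] [IsDomain B] {φ : A →+* B}
  {H : Type v} [Ring H] [Algebra A H] [Module.Free A H] [Module.Finite A H] {t : H →ₗ[A] A}

/-- A Noetherian local domain is a principal ideal ring as soon as its maximal ideal is principal.
-/
lemma isPrincipalIdealRing_localization_of_isPrincipal {A : Type*} [CommRing A] [IsDomain A]
    [IsNoetherianRing A] (P : Ideal A) [P.IsPrime] (hP : P.IsPrincipal) :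
    IsPrincipalIdealRing (Localization.AtPrime P) := by
  have : IsNoetherianRing (Localization.AtPrime P) :=
    IsLocalization.isNoetherianRing P.primeCompl _ inferInstance
  have h := (tfae_of_isNoetherianRing_of_isLocalRing_of_isDomain (Localization.AtPrime P)).out 4 0
  refine h.1 ?_
  rw [← Localization.AtPrime.map_eq_maximalIdeal]
  obtain ⟨x, hx⟩ := hP
  have h2 := congrArg (Ideal.map (algebraMap A (Localization.AtPrime P))) hx
  rw [Ideal.submodule_span_eq, Ideal.map_span, Set.image_singleton] at h2
  exact ⟨algebraMap A _ x, h2⟩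

/-- Specialization along a surjective morphism with principal kernel that does not kill the Schur
elements: the specialized algebra is split semisimple, with the same characters and the same blocks
at the primes that correspond to each other. -/
theorem exists_titsBijection_blocksAt (hφ : Function.Surjective φ)
    (hker : (RingHom.ker φ).IsPrincipal) (ht : IsSymmetrizing t)
    (hss : IsSplitSemisimple (FractionRing A) (FracAlgebra A H))
    (hschur : ∀ χ : Irr (FractionRing A) (FracAlgebra A H), ∃ s : A,
      IsSchurElement t χ (algebraMap A (FractionRing A) s) ∧ (s ≠ 0 → φ s ≠ 0))
    (P : Ideal B) [P.IsPrime] (Q : Ideal A) [Q.IsPrime] (hQ : ∀ a, a ∈ Q ↔ φ a ∈ P) :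
    IsSplitSemisimple (FractionRing B) (FracAlgebra B (Specialized φ H)) ∧
    ∃ σ : Irr (FractionRing A) (FracAlgebra A H) ≃
        Irr (FractionRing B) (FracAlgebra B (Specialized φ H)),
      IsTitsBijection φ H σ ∧
      ∀ C, C ∈ blocksAt A H Q ↔ σ '' C ∈ blocksAt B (Specialized φ H) P := by
  let F := FractionRing A
  let L := FractionRing B
  have : (RingHom.ker φ).IsPrime := RingHom.ker_isPrime φ
  let O := Localization.AtPrime (RingHom.ker φ)
  have : IsPrincipalIdealRing O := isPrincipalIdealRing_localization_of_isPrincipal _ hker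
  let _ : Algebra O F := (locToFrac A (RingHom.ker φ)).toRingHom.toAlgebra
  have : IsScalarTower A O F :=
    IsScalarTower.of_algebraMap_eq fun a => ((locToFrac A (RingHom.ker φ)).commutes a).symm
  have : IsFractionRing O F :=
    IsFractionRing.isFractionRing_of_isDomain_of_isLocalization (RingHom.ker φ).primeCompl O F
  have hOF : Function.Injective (algebraMap O F) := IsFractionRing.injective O F
  have hBL : Function.Injective (algebraMap B L) := IsFractionRing.injective B L
  let _ : Algebra A L := ((algebraMap B L).comp φ).toAlgebra
  have hAL (a : A) : algebraMap A L a = algebraMap B L (φ a) := rfl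
  -- The reduction map: elements outside `ker φ` become nonzero in `L`, so `φ` extends to `O`.
  let ψ : O →ₐ[A] L := IsLocalization.liftAlgHom (M := (RingHom.ker φ).primeCompl)
    (f := Algebra.ofId A L) fun y => by
      rw [isUnit_iff_ne_zero]
      exact fun h0 => y.2 (hBL (h0.trans (map_zero _).symm))
  obtain ⟨k, n, hn, ⟨Φ₀⟩⟩ := exists_algEquiv_of_isSplitSemisimple hss
  obtain ⟨Φ, ρ, hρ⟩ := exists_integral_model (O := O) Φ₀
  have hsurj (i : Fin k) (E : Matrix (Fin (n i)) (Fin (n i)) O) : ∃ d, φ d ≠ 0 ∧ ∃ h : H,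
      ρ i h = algebraMap A O d • E ∧ ∀ j ≠ i, ρ j h = 0 := by
    obtain ⟨s, hs, hs0⟩ := hschur (irrEquiv Φ i)
    have hs' : s ∉ RingHom.ker φ := hs0 fun h0 =>
      schurElement_ne_zero Φ hs (by rw [h0, map_zero])
    exact exists_eq_single_smul Φ (RingHom.ker φ) ht ρ hρ i hs' hs E
  obtain ⟨Φ', hΦ'⟩ := exists_algEquiv_specialized Φ ρ hsurj (ψ : O →+* L) fun a => ψ.commutes a
  have hchar (i : Fin k) (h : H) := exists_map_eq_charpoly (A := A) hOF (ρ i) h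
  have hsets (C : Set (Fin k)) : IsIdempotentSet Q Φ C ↔ IsIdempotentSet P Φ' C := by
    rw [isIdempotentSet_iff, isIdempotentSet_iff]
    constructor
    · rintro ⟨d, hd, h, hh⟩
      refine ⟨φ d, fun h0 => hd ((hQ d).2 h0), specialize φ h, funext fun i => ?_⟩
      have hi : (ρ i h).map (algebraMap O F) = _ := (hρ h i).symm.trans (congrFun hh i)
      refine (hΦ' h i).trans ?_
      by_cases hiC : i ∈ C
      · rw [smul_piIndicator_of_mem _ hiC] at hi ⊢
        have h1 : ρ i h = Matrix.scalar _ (algebraMap A O d) := by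
          apply Matrix.map_injective hOF
          refine hi.trans ?_
          dsimp only
          rw [Matrix.scalar_apply, Matrix.scalar_apply, Matrix.diagonal_map (map_zero _)]
          exact congrArg _ (funext fun _ => IsScalarTower.algebraMap_apply A O F d)
        rw [h1, Matrix.scalar_apply, Matrix.scalar_apply, Matrix.diagonal_map (map_zero _)]
        exact congrArg _ (funext fun _ => ψ.commutes d)
      · rw [smul_piIndicator_of_notMem _ hiC] at hi ⊢
        have h1 : ρ i h = 0 := by
          apply Matrix.map_injective hOF
          refine hi.trans ?_
          dsimp only
          rw [Matrix.map_zero _ (map_zero _)]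
        rw [h1, Matrix.map_zero _ (map_zero _)]
    · rintro ⟨d', hd', h', hh⟩
      obtain ⟨d, rfl⟩ := hφ d'
      obtain ⟨h, rfl⟩ := specialize_surjective φ hφ h'
      obtain ⟨g, c, l, hc, hg, hg'⟩ := exists_eq_scalar_of_map_eq_scalar ψ ρ hchar C
        (h := h) (d := d)
        (fun i hi => ((hΦ' h i).symm.trans (congrFun hh i)).trans (smul_piIndicator_of_mem _ hi))
        (fun i hi => ((hΦ' h i).symm.trans (congrFun hh i)).trans (smul_piIndicator_of_notMem _ hi))
      refine ⟨c, ?_, g, funext fun i => ?_⟩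
      · have hcP : φ c = φ d ^ l ∨ φ c = -φ d ^ l := by
          rw [hAL, hAL, ← map_pow, ← map_neg] at hc
          exact hc.imp (fun h => hBL h) (fun h => hBL h)
        rw [hQ]
        rcases hcP with h | h <;> rw [h]
        · exact fun h0 => hd' (‹P.IsPrime›.mem_of_pow_mem _ h0)
        · exact fun h0 => hd' (‹P.IsPrime›.mem_of_pow_mem _ (neg_mem_iff.1 h0))
      · rw [hρ]
        by_cases hi : i ∈ C
        · rw [hg i hi, smul_piIndicator_of_mem _ hi, Matrix.scalar_apply, Matrix.scalar_apply,
            Matrix.diagonal_map (map_zero _)]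
          exact congrArg _ (funext fun _ => (IsScalarTower.algebraMap_apply A O F c).symm)
        · rw [hg' i hi, smul_piIndicator_of_notMem _ hi, Matrix.map_zero _ (map_zero _)]
  refine ⟨isSplitSemisimple_of_algEquiv Φ', (irrEquiv Φ).symm.trans (irrEquiv Φ'), ?_, ?_⟩
  · intro χ h
    obtain ⟨i, rfl⟩ := (irrEquiv Φ).surjective χ
    obtain ⟨f, hf⟩ := hchar i h
    -- The trace is read off the characteristic polynomial, so it lies in `A` and not merely in `O`.
    -- The truncated `n i - 1` is harmless because `n i ≠ 0`.
    have htr : (ρ i h).trace = algebraMap A O (-f.coeff (n i - 1)) := by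
      rw [Matrix.trace_eq_neg_charpoly_coeff, ← hf, Polynomial.coeff_map, map_neg, Fintype.card_fin]
    refine ⟨-f.coeff (n i - 1), ?_, ?_⟩
    · rw [irrEquiv_apply, hρ, IsScalarTower.algebraMap_apply A O F, ← htr]
      exact (AddMonoidHom.map_trace (algebraMap O F).toAddMonoidHom _).symm
    · rw [Equiv.trans_apply, Equiv.symm_apply_apply, irrEquiv_apply, hΦ', ← hAL, ← ψ.commutes,
        ← htr]
      exact (AddMonoidHom.map_trace (ψ : O →+* L).toAddMonoidHom _).symm
  · intro C
    obtain ⟨D, rfl⟩ := (irrEquiv Φ).surjective.image_surjective C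
    have hD : (irrEquiv Φ).symm.trans (irrEquiv Φ') '' (irrEquiv Φ '' D) = irrEquiv Φ' '' D := by
      rw [← Set.image_comp]
      congr 1
      funext i
      simp
    rw [hD, image_mem_blocksAt_iff, image_mem_blocksAt_iff]
    simp only [hsets]

end Main

/-! ### Laurent polynomials -/

section LaurentRing

variable (R : Type u) [CommRing R]

/-- Splitting off the first indeterminate. -/
def laurentSuccEquiv (k : ℕ) : Laurent R (k + 1) ≃+* LaurentPolynomial (Laurent R k) :=
  (AddMonoidAlgebra.mapDomainRingEquiv R
    ({ (Fin.consEquiv fun _ : Fin (k + 1) => ℤ).symm with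
        map_add' := fun _ _ => rfl } : (Fin (k + 1) → ℤ) ≃+ ℤ × (Fin k → ℤ))).trans
    AddMonoidAlgebra.curryRingEquiv

/-- Polynomials in one variable over an integrally closed domain are integrally closed, and
inverting the variable preserves this; the indeterminates are adjoined one at a time. -/
instance isIntegrallyClosed_laurent [IsDomain R] [IsIntegrallyClosed R] :
    ∀ k : ℕ, IsIntegrallyClosed (Laurent R k)
  | 0 => IsIntegrallyClosed.of_equiv (AddMonoidAlgebra.uniqueRingEquiv (R := R) (Fin 0 → ℤ)).symm
  | k + 1 => by
    have := isIntegrallyClosed_laurent k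
    have : IsIntegrallyClosed (LaurentPolynomial (Laurent R k)) :=
      isIntegrallyClosed_of_isLocalization (R := Polynomial (Laurent R k)) _
        (Submonoid.powers Polynomial.X)
        (Submonoid.powers_le.2 (mem_nonZeroDivisors_of_ne_zero Polynomial.X_ne_zero))
    exact IsIntegrallyClosed.of_equiv (laurentSuccEquiv R k).symm

instance isNoetherianRing_laurent [IsNoetherianRing R] (k : ℕ) :
    IsNoetherianRing (Laurent R k) := by
  have : AddMonoid.FG (Fin k → ℤ) := AddGroup.fg_iff_addMonoid_fg.1 inferInstance
  exact Algebra.FiniteType.isNoetherianRing R (Laurent R k)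

/-- The extended ideal is the kernel of coefficientwise reduction to Laurent polynomials over `R ⧸
p`, which form a domain. -/
lemma isPrime_map_algebraMap_laurent (p : Ideal R) [p.IsPrime] (k : ℕ) :
    (p.map (algebraMap R (Laurent R k))).IsPrime := by
  let g : Laurent R k →+* Laurent (R ⧸ p) k :=
    AddMonoidAlgebra.mapRingHom (Fin k → ℤ) (Ideal.Quotient.mk p)
  have hg : p.map (algebraMap R (Laurent R k)) = RingHom.ker g := by
    apply le_antisymm
    · rw [Ideal.map_le_iff_le_comap]
      intro r hr
      have h0 : Ideal.Quotient.mk p r = 0 := Ideal.Quotient.eq_zero_iff_mem.2 hr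
      rw [Ideal.mem_comap, RingHom.mem_ker]
      simp [g, h0]
    · intro x hx
      have hc (l : Fin k → ℤ) : x.coeff l ∈ p := by
        rw [← Ideal.Quotient.eq_zero_iff_mem]
        have := congrArg (fun z => z.coeff l) (RingHom.mem_ker.1 hx)
        simpa [g] using this
      rw [← AddMonoidAlgebra.sum_coeff_single x]
      refine Ideal.sum_mem _ fun l _ => ?_
      have : AddMonoidAlgebra.single l (x.coeff l) =
          algebraMap R (Laurent R k) (x.coeff l) * AddMonoidAlgebra.single l 1 := by
        simp
      rw [this]
      exact Ideal.mul_mem_right _ _ (Ideal.mem_map_of_mem _ (hc l))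
  rw [hg]
  exact RingHom.ker_isPrime g

variable {R}

lemma monomial_add {k : ℕ} (b c : Fin k → ℤ) :
    monomial R (b + c) = monomial R b * monomial R c := by
  simp [monomial, AddMonoidAlgebra.single_mul_single]

lemma monomial_zero {k : ℕ} : monomial R (0 : Fin k → ℤ) = 1 := rfl

lemma monomial_ne_zero [Nontrivial R] {k : ℕ} (b : Fin k → ℤ) : monomial R b ≠ 0 := by
  simp [monomial]

lemma monomial_zsmul_sub_one_mem {k : ℕ} (a : Fin k → ℤ) (z : ℤ) :
    monomial R (z • a) - 1 ∈ Ideal.span {monomial R a - 1} := by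
  rw [← Ideal.Quotient.eq_zero_iff_mem, map_sub, sub_eq_zero, map_one]
  have h1 : Ideal.Quotient.mk (Ideal.span {monomial R a - 1}) (monomial R a) = 1 := by
    rw [← sub_eq_zero, ← map_one (Ideal.Quotient.mk _), ← map_sub, Ideal.Quotient.eq_zero_iff_mem]
    exact Ideal.mem_span_singleton_self _
  induction z with
  | zero => rw [zero_smul, monomial_zero, map_one]
  | succ i ih => rw [add_smul, one_smul, monomial_add, map_mul, ih, h1, one_mul]
  | pred i ih =>
    have h2 : monomial R (-(i : ℤ) • a) = monomial R ((-(i : ℤ) - 1) • a) * monomial R a := by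
      rw [← monomial_add, sub_smul, one_smul, sub_add_cancel]
    rwa [h2, map_mul, h1, mul_one] at ih

/-- The exponents `i • b` are pairwise distinct, so the leading coefficient of `f` survives. -/
lemma aeval_monomial_ne_zero {k : ℕ} {b : Fin k → ℤ} (hb : b ≠ 0) {f : Polynomial R} (hf : f ≠ 0) :
    Polynomial.aeval (monomial R b) f ≠ 0 := by
  intro h
  have h1 := congrArg (fun z => z.coeff (f.natDegree • b)) h
  have hinj (i j : ℕ) : i • b = j • b ↔ i = j := by
    refine ⟨fun hij => ?_, fun hij => hij ▸ rfl⟩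
    obtain ⟨l, hl⟩ := Function.ne_iff.1 hb
    have := congrFun hij l
    exact (by simpa using this : i = j ∨ b l = 0).resolve_right hl
  rw [Polynomial.aeval_eq_sum_range] at h1
  simp [monomial, AddMonoidAlgebra.single_pow, Finsupp.single_apply, hinj, -nsmul_eq_mul] at h1
  exact hf h1

end LaurentRing

/-! ### Morphisms associated with a monomial. -/

section Associated

variable {R : Type u} [CommRing R] {m : ℕ} {a : Fin (m + 1) → ℤ}
  {φ : Laurent R (m + 1) →ₐ[R] Laurent R m}

lemma laurent_induction {k : ℕ} {motive : Laurent R k → Prop} (x : Laurent R k)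
    (zero : motive 0) (add : ∀ x y, motive x → motive y → motive (x + y))
    (smul_monomial : ∀ (r : R) l, motive (r • monomial R l)) : motive x := by
  induction x using AddMonoidAlgebra.induction_linear with
  | zero => exact zero
  | add x y hx hy => exact add x y hx hy
  | single l r =>
    have := smul_monomial r l
    rwa [monomial, AddMonoidAlgebra.smul_single, smul_eq_mul, mul_one] at this

lemma IsAssociatedWith.surjective (hφ : IsAssociatedWith a φ) : Function.Surjective φ := by
  obtain ⟨f, hf, -, hφf⟩ := hφ
  intro y
  induction y using laurent_induction with
  | zero => exact ⟨0, map_zero _⟩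
  | add x y hx hy =>
    obtain ⟨x, rfl⟩ := hx
    obtain ⟨y, rfl⟩ := hy
    exact ⟨x + y, map_add _ _ _⟩
  | smul_monomial r l =>
    obtain ⟨l, rfl⟩ := hf l
    exact ⟨r • monomial R l, by rw [map_smul, hφf]⟩

lemma IsAssociatedWith.ker_eq (hφ : IsAssociatedWith a φ) :
    RingHom.ker φ.toRingHom = Ideal.span {monomial R a - 1} := by
  obtain ⟨f, hf, hker, hφf⟩ := hφ
  let I := Ideal.span {monomial R a - 1}
  apply le_antisymm
  · obtain ⟨s, hs⟩ := hf.hasRightInverse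
    -- Here `s` is only a set-theoretic section, so `τ` is just `R`-linear. This suffices: once `τ ∘
    -- φ` is the quotient map, `ker φ` lies in `I`.
    let τ : Laurent R m →ₗ[R] Laurent R (m + 1) ⧸ I :=
      Finsupp.linearCombination R (fun b => Ideal.Quotient.mk I (monomial R (s b))) ∘ₗ
        (AddMonoidAlgebra.coeffLinearEquiv R).toLinearMap
    have hτ (b : Fin m → ℤ) : τ (monomial R b) = Ideal.Quotient.mk I (monomial R (s b)) := by
      simp [τ, monomial]
    have hcomp (x : Laurent R (m + 1)) : τ (φ x) = Ideal.Quotient.mkₐ R I x := by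
      induction x using laurent_induction with
      | zero => simp
      | add x y hx hy => rw [map_add, map_add, map_add, hx, hy]
      | smul_monomial r l =>
        rw [map_smul, map_smul, map_smul, hφf, hτ]
        congr 1
        have hl : l - s (f l) ∈ f.ker := by
          rw [AddMonoidHom.mem_ker, map_sub, hs, sub_self]
        rw [hker] at hl
        obtain ⟨z, hz⟩ := AddSubgroup.mem_zmultiples_iff.1 hl
        have h1 : monomial R l = monomial R (z • a) * monomial R (s (f l)) := by
          rw [hz, ← monomial_add, sub_add_cancel]
        have h2 := Ideal.Quotient.eq_zero_iff_mem.2 (monomial_zsmul_sub_one_mem (R := R) a z)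
        rw [map_sub, map_one, sub_eq_zero] at h2
        rw [Ideal.Quotient.mkₐ_eq_mk, h1, map_mul, h2, one_mul]
    intro x hx
    have hx' : φ x = 0 := hx
    rw [← Ideal.Quotient.eq_zero_iff_mem, ← Ideal.Quotient.mkₐ_eq_mk R, ← hcomp, hx', map_zero]
  · rw [Ideal.span_le, Set.singleton_subset_iff]
    have ha : f a = 0 := by
      have : a ∈ f.ker := hker ▸ AddSubgroup.mem_zmultiples a
      exact this
    change φ (monomial R a - 1) = 0
    rw [map_sub, hφf, ha, monomial_zero, map_one, sub_self]

/-- For surjective `φ`, the preimage of the image of an ideal is that ideal plus `ker φ`, here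
generated by `M - 1`. -/
lemma IsAssociatedWith.idealQ_eq_comap (hφ : IsAssociatedWith a φ) (p : Ideal R) :
    idealQ R p a = (p.map (algebraMap R (Laurent R m))).comap φ.toRingHom := by
  have h1 : p.map (algebraMap R (Laurent R m)) =
      (p.map (algebraMap R (Laurent R (m + 1)))).map φ.toRingHom := by
    rw [Ideal.map_map]
    congr 1
    exact φ.comp_algebraMap.symm
  rw [h1, Ideal.comap_map_of_surjective' φ.toRingHom hφ.surjective, hφ.ker_eq]
  rfl

/-- The factors of the Schur elements of an essential algebra are not killed by a morphism
associated with a monomial. -/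
lemma IsAssociatedWith.map_aeval_monomial_ne_zero [IsDomain R] (hφ : IsAssociatedWith a φ)
    {Ψ : Polynomial R} (hΨ : Ψ ≠ 0)
    (hcop : IsCoprime (Ψ.map (algebraMap R (FractionRing R))) (Polynomial.X - 1))
    (l : Fin (m + 1) → ℤ) : φ (Polynomial.aeval (monomial R l) Ψ) ≠ 0 := by
  obtain ⟨f, -, -, hφf⟩ := hφ
  rw [← Polynomial.aeval_algHom_apply, hφf]
  by_cases hl : f l = 0
  · have h1 := hcop.map (Polynomial.evalRingHom 1)
    rw [map_sub, map_one, Polynomial.coe_evalRingHom, Polynomial.eval_X, sub_self,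
      isCoprime_zero_right, Polynomial.eval_one_map] at h1
    rw [hl, monomial_zero, ← map_one (algebraMap R (Laurent R m)),
      Polynomial.aeval_algebraMap_apply, Polynomial.coe_aeval_eq_eval]
    intro h0
    rw [FaithfulSMul.algebraMap_injective R (Laurent R m) (h0.trans (map_zero _).symm),
      map_zero] at h1
    exact not_isUnit_zero h1
  · exact aeval_monomial_ne_zero hl hΨ

end Associated

end EssentialBlocks

end

theorem mainTheorem2 {R : Type*} [CommRing R] [IsDomain R] [IsNoetherianRing R]
    [IsIntegrallyClosed R] (m : ℕ)
    {H : Type*} [Ring H] [Algebra (Laurent R (m + 1)) H]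
    [Module.Free (Laurent R (m + 1)) H] [Module.Finite (Laurent R (m + 1)) H]
    (t : H →ₗ[Laurent R (m + 1)] Laurent R (m + 1))
    (ht : IsSymmetrizing t)
    (hss : IsSplitSemisimple (FractionRing (Laurent R (m + 1)))
      (FracAlgebra (Laurent R (m + 1)) H))
    (hess : IsEssential t)
    (a : Fin (m + 1) → ℤ) (ha : Finset.univ.gcd a = 1)
    (φ : Laurent R (m + 1) →ₐ[R] Laurent R m)
    (hφ : IsAssociatedWith a φ)
    (p : Ideal R) [p.IsPrime] :
    IsSplitSemisimple (FractionRing (Laurent R m))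
      (FracAlgebra (Laurent R m) (Specialized φ.toRingHom H)) ∧
    ∃ (_ : (idealQ R p a).IsPrime)
      (_ : (p.map (algebraMap R (Laurent R m))).IsPrime)
      (σ : Irr (FractionRing (Laurent R (m + 1))) (FracAlgebra (Laurent R (m + 1)) H) ≃
        Irr (FractionRing (Laurent R m))
          (FracAlgebra (Laurent R m) (Specialized φ.toRingHom H))),
      IsTitsBijection φ.toRingHom H σ ∧
      ∀ C, C ∈ blocksAt (Laurent R (m + 1)) H (idealQ R p a) ↔
        σ '' C ∈ blocksAt (Laurent R m) (Specialized φ.toRingHom H)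
          (p.map (algebraMap R (Laurent R m))) := by
  have hP := isPrime_map_algebraMap_laurent R p m
  have hQ : (idealQ R p a).IsPrime := by
    rw [hφ.idealQ_eq_comap]
    exact Ideal.comap_isPrime _ _
  have hker : (RingHom.ker φ.toRingHom).IsPrincipal := ⟨monomial R a - 1, hφ.ker_eq⟩
  have hschur (χ : Irr (FractionRing (Laurent R (m + 1))) (FracAlgebra (Laurent R (m + 1)) H)) :
      ∃ s, IsSchurElement t χ (algebraMap _ _ s) ∧ (s ≠ 0 → φ.toRingHom s ≠ 0) := by
    obtain ⟨ξ, N, k, Ψ, M, r, -, hΨ, -, -, hs⟩ := hess χ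
    refine ⟨_, hs, fun h0 => ?_⟩
    -- Essentiality alone allows `ξ = 0`; the nonvanishing of the Schur element excludes it.
    have hξ : ξ ≠ 0 := by
      rintro rfl
      exact h0 (by rw [map_zero, zero_mul, zero_mul])
    change φ _ ≠ 0
    rw [map_mul, map_mul, AlgHom.commutes, map_prod]
    refine mul_ne_zero (mul_ne_zero ?_ ?_) (Finset.prod_ne_zero_iff.2 fun i _ => ?_)
    · exact fun h => hξ (FaithfulSMul.algebraMap_injective R (Laurent R m)
        (h.trans (map_zero _).symm))
    · obtain ⟨f, -, -, hφf⟩ := hφ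
      rw [hφf]
      exact monomial_ne_zero _
    · rw [map_pow]
      exact pow_ne_zero _ (hφ.map_aeval_monomial_ne_zero (hΨ i).1.ne_zero (hΨ i).2.2.2.2.1 _)
  obtain ⟨hsplit, σ, hσ, hblocks⟩ := exists_titsBijection_blocksAt hφ.surjective hker ht hss hschur
    (p.map (algebraMap R (Laurent R m))) (idealQ R p a)
    (fun x => by rw [hφ.idealQ_eq_comap, Ideal.mem_comap])
  exact ⟨hsplit, hQ, hP, σ, hσ, hblocks⟩
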